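/- Let $d\ge 2$, let $\Omega\subset\mathbb R^d$ be a bounded domain (open and connected), let $p\in(1,\infty)$ with $p\ge \frac{2d}{d+2}$, let $T>0$, $I=(0,T)$, and let $K_1\ge 0$. For $\delta\in[0,1]$ and $P\in\mathbb R^{d\times d}$ with symmetric part $P^{\rm sym}=\frac12(P+P^\top)$ and Hilbert–Schmidt norm $|\cdot|$ put $$S(P)=(\delta+|P^{\rm sym}|)^{p-2}P^{\rm sym},\qquad F(P)=(\delta+|P^{\rm sym}|)^{\frac{p-2}{2}}P^{\rm sym},\qquad S(0)=F(0)=0,$$ and let $Du=\frac12(\nabla u+\nabla u^\top)$ and $(u,v)=\int_\Omega u\cdot v\,dx$. Then there is a constant $c$, depending only on $d,p,\Omega,T$ and $K_1$, such that the following holds. Let $\delta\in[0,1]$, $f\in W^{1,2}(I,L^2(\Omega)^d)$ (identified with its continuous representative on $[0,T]$) and $u_0\in W^{1,p}_{0,\mathrm{div}}(\Omega)$ with $$\|f\|_{W^{1,2}(I,L^2(\Omega))}+\|u_0\|_{W^{1,p}(\Omega)}+\|\nabla F(Du_0)\|_{L^2(\Omega)}+\|\nabla S(Du_0)\|_{L^2(\Omega)}\le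 K_1 .$$ Let $\mathcal T_h$ be a finite decomposition of $\Omega$ into simplices without hanging nodes (two closed simplices meet exactly in a common face or not at all), let $k,r\in\mathbb N_0$, and let $$X_h=\{v\in W^{1,p}_0(\Omega)^d: v|_{T'}\in\mathcal P_k(T')^d\ \forall\, T'\in\mathcal T_h,\ v|_{\partial\Omega}=0\},\qquad Y_h=\{q\in L^{p'}(\Omega): q|_{T'}\in\mathcal P_r(T')\ \forall\, T'\in\mathcal T_h\},$$ $$V_h=\{v\in X_h:(q,\operatorname{div}v)=0\ \ \forall\, q\in Y_h\},$$ where $p'=\frac p{p-1}$ and $\mathcal P_l(T')$ is the space of polynomials on $T'$ of degree at most $l$. Let $u_0^h\in V_h$ satisfy $(S(Du_0^h),D\xi)=(S(Du_0),D\xi)$ for all $\xi\in V_h$, and let $u_h\in C^1([0,T],V_h)$ satisfy $u_h(0)=u_0^h$ and $$(\partial_tu_h(t),\xi)+(S(Du_h(t)),D\xi)=(f(t),\xi)\qquad\text{for all } t\in[0,T],\ \xi\in V_h .$$ Let $M\ge1$ be an integer, $\Delta t=T/M$, $t_n=n\Delta t$, and let $U^0=u_0^h$ and $U^1,\dots,U^M\in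 V_h$ solve the implicit Euler scheme $$\Big(\frac{U^n-U^{n-1}}{\Delta t},\xi\Big)+(S(DU^n),D\xi)=\Big(\frac1{\Delta t}\int_{t_{n-1}}^{t_n}f(s)\,ds,\ \xi\Big)\qquad\text{for all } \xi\in V_h,\ n=1,\dots,M .$$ If $\Delta t\le\alpha<1$, then $$\sup_{1\le n\le M}\|u_h(t_n)-U^n\|_{L^2(\Omega)}^2+\Delta t\sum_{n=1}^M\|F(Du_h(t_n))-F(DU^n)\|_{L^2(\Omega)}^2\le c\,(\Delta t)^2 .$$ In particular $c$ does not depend on $\delta$, $\mathcal T_h$, $h$, $k$, $r$, $\Delta t$, $M$ or $\alpha$. -/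

import Mathlib

open MeasureTheory Set Filter Topology
open scoped ENNReal NNReal ContDiff

namespace GenStokes

noncomputable section

/-- Vectors in `ℝ^d` with the Euclidean norm. -/
abbrev Vec (d : ℕ) := EuclideanSpace ℝ (Fin d)

/-- Tensors in `ℝ^{d×d}`; the norm is the Hilbert-Schmidt norm and the inner product is `A : B`. -/
abbrev Tensor (d : ℕ) := EuclideanSpace ℝ (Fin d × Fin d)

/-! ### The extra stress tensor -/

/-- The symmetric part `(P + Pᵀ) / 2`. -/
def symPart {d : ℕ} (P : Tensor d) : Tensor d :=
  WithLp.toLp 2 fun ij => (P ij + P (ij.2, ij.1)) / 2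

/-- The derivative `φ'(t) = (δ + t)^(p-2) t` of the N-function with `(p, δ)`-structure. -/
def phiDeriv (p δ t : ℝ) : ℝ := (δ + t) ^ (p - 2) * t

/-- The extra stress tensor `S(P) = φ'(|P^sym|) / |P^sym| P^sym`, with `S(0) = 0`. -/
def stress {d : ℕ} (p δ : ℝ) (P : Tensor d) : Tensor d :=
  (phiDeriv p δ ‖symPart P‖ / ‖symPart P‖) • symPart P

/-- `F(P) = (δ + |P^sym|)^((p-2)/2) P^sym`. -/
def natF {d : ℕ} (p δ : ℝ) (P : Tensor d) : Tensor d :=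
  (δ + ‖symPart P‖) ^ ((p - 2) / 2) • symPart P

/-! ### Sobolev spaces -/

/-- `G` is the weak gradient of `u` in `Ω`, that is `G (i, j) = ∂_j u_i` in the distributional
sense. The target may have any finite number of components, so that tensor fields are included. -/
def HasWeakGrad {d : ℕ} {ι : Type*} [Fintype ι] (Ω : Set (Vec d))
    (u : Vec d → EuclideanSpace ℝ ι) (G : Vec d → EuclideanSpace ℝ (ι × Fin d)) : Prop :=
  LocallyIntegrableOn u Ω ∧ LocallyIntegrableOn G Ω ∧
    ∀ η : Vec d → ℝ, ContDiff ℝ ∞ η → HasCompactSupport η → tsupport η ⊆ Ω →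
      ∀ (i : ι) (j : Fin d),
        ∫ x in Ω, u x i * fderiv ℝ η x (EuclideanSpace.single j 1) =
          -∫ x in Ω, G x (i, j) * η x

/-- `u` has a weak gradient in `Ω`. -/
def WeaklyDifferentiable {d : ℕ} {ι : Type*} [Fintype ι] (Ω : Set (Vec d))
    (u : Vec d → EuclideanSpace ℝ ι) : Prop :=
  ∃ G, HasWeakGrad Ω u G

open Classical in
/-- The weak gradient of `u` in `Ω`, which is unique up to null sets
(and `0` if `u` is not weakly differentiable). -/
def weakGrad {d : ℕ} {ι : Type*} [Fintype ι] (Ω : Set (Vec d))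
    (u : Vec d → EuclideanSpace ℝ ι) : Vec d → EuclideanSpace ℝ (ι × Fin d) :=
  if h : WeaklyDifferentiable Ω u then h.choose else 0

/-- The symmetric gradient `Du`. -/
def symGrad {d : ℕ} (Ω : Set (Vec d)) (u : Vec d → Vec d) (x : Vec d) : Tensor d :=
  symPart (weakGrad Ω u x)

/-- The divergence `div u`. -/
def weakDiv {d : ℕ} (Ω : Set (Vec d)) (u : Vec d → Vec d) (x : Vec d) : ℝ :=
  ∑ i, weakGrad Ω u x (i, i)

/-- The `L^q(Ω)` norm, with values in `[0, ∞]`. -/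
def lqNorm {d : ℕ} {ι : Type*} [Fintype ι] (Ω : Set (Vec d)) (q : ℝ)
    (u : Vec d → EuclideanSpace ℝ ι) : ℝ≥0∞ :=
  eLpNorm u (ENNReal.ofReal q) (volume.restrict Ω)

/-- The `W^{1,p}(Ω)` norm of a weakly differentiable vector field. -/
def w1pNorm {d : ℕ} (Ω : Set (Vec d)) (p : ℝ) (u : Vec d → Vec d) : ℝ≥0∞ :=
  lqNorm Ω p u + lqNorm Ω p (weakGrad Ω u)

/-- `u ∈ W^{1,p}(Ω)`. -/
def MemW1p {d : ℕ} (Ω : Set (Vec d)) (p : ℝ) (u : Vec d → Vec d) : Prop :=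
  WeaklyDifferentiable Ω u ∧ MemLp u (ENNReal.ofReal p) (volume.restrict Ω) ∧
    MemLp (weakGrad Ω u) (ENNReal.ofReal p) (volume.restrict Ω)

/-- `u ∈ W_0^{1,p}(Ω)`, the closure of the smooth compactly supported fields in `W^{1,p}(Ω)`. -/
def MemW1pZero {d : ℕ} (Ω : Set (Vec d)) (p : ℝ) (u : Vec d → Vec d) : Prop :=
  MemW1p Ω p u ∧
    ∀ ε : ℝ≥0∞, 0 < ε → ∃ η : Vec d → Vec d,
      ContDiff ℝ ∞ η ∧ HasCompactSupport η ∧ tsupport η ⊆ Ω ∧ w1pNorm Ω p (u - η) < ε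

/-- `u ∈ W_{0,div}^{1,p}(Ω)`. -/
def MemW1pZeroDiv {d : ℕ} (Ω : Set (Vec d)) (p : ℝ) (u : Vec d → Vec d) : Prop :=
  MemW1pZero Ω p u ∧ ∀ᵐ x ∂(volume.restrict Ω), weakDiv Ω u x = 0

/-- The space `L²(Ω)` of vector fields. -/
abbrev L2Vec {d : ℕ} (Ω : Set (Vec d)) := Lp (Vec d) 2 (volume.restrict Ω)

/-- `f ∈ W^{1,2}((0,T), L²(Ω))` with weak time derivative `f'`, where `f` denotes the
representative that is (absolutely) continuous on `[0,T]`. -/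
def MemW12Time {d : ℕ} {Ω : Set (Vec d)} (T : ℝ) (f f' : ℝ → L2Vec Ω) : Prop :=
  MemLp f' 2 (volume.restrict (Ioo 0 T)) ∧
    ∀ t ∈ Icc 0 T, f t = f 0 + ∫ s in (0 : ℝ)..t, f' s

/-- The norm of `L²((0,T), L²(Ω))`. -/
def l2TimeNorm {d : ℕ} {Ω : Set (Vec d)} (T : ℝ) (f : ℝ → L2Vec Ω) : ℝ≥0∞ :=
  eLpNorm f 2 (volume.restrict (Ioo 0 T))

/-! ### The data -/

/-- The assumptions on the external force `f` (with time derivative `f'`) and the initial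
velocity `u₀`: `f ∈ W^{1,2}(I, L²)`, `u₀ ∈ W_{0,div}^{1,p}` and
`‖f‖_{W^{1,2}(I,L²)} + ‖u₀‖_{W^{1,p}} + ‖∇F(Du₀)‖_{L²} + ‖∇S(Du₀)‖_{L²} ≤ K₁`. -/
structure AdmissibleData {d : ℕ} (Ω : Set (Vec d)) (p δ T : ℝ) (K₁ : ℝ≥0)
    (f f' : ℝ → L2Vec Ω) (u₀ : Vec d → Vec d) : Prop where
  force : MemW12Time T f f'
  initial : MemW1pZeroDiv Ω p u₀
  weaklyDiff_natF : WeaklyDifferentiable Ω fun x => natF p δ (symGrad Ω u₀ x)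
  weaklyDiff_stress : WeaklyDifferentiable Ω fun x => stress p δ (symGrad Ω u₀ x)
  bound : (l2TimeNorm T f + l2TimeNorm T f') + w1pNorm Ω p u₀ +
      lqNorm Ω 2 (weakGrad Ω fun x => natF p δ (symGrad Ω u₀ x)) +
      lqNorm Ω 2 (weakGrad Ω fun x => stress p δ (symGrad Ω u₀ x)) ≤ K₁

/-! ### Finite elements -/

/-- A finite decomposition of `Ω` into simplices without hanging nodes. A simplex is given by
its `d + 1` vertices; two closed simplices meet exactly in their common face. -/
structure Triangulation {d : ℕ} (Ω : Set (Vec d)) where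
  cells : Finset (Finset (Vec d))
  card_eq : ∀ T ∈ cells, T.card = d + 1
  indep : ∀ T ∈ cells, AffineIndependent ℝ ((↑) : T → Vec d)
  inter : ∀ T ∈ cells, ∀ T' ∈ cells,
    convexHull ℝ (T : Set (Vec d)) ∩ convexHull ℝ (T' : Set (Vec d)) =
      convexHull ℝ ((T : Set (Vec d)) ∩ (T' : Set (Vec d)))
  interior_subset : ∀ T ∈ cells, interior (convexHull ℝ (T : Set (Vec d))) ⊆ Ω
  cover : ⋃ T ∈ cells, convexHull ℝ (T : Set (Vec d)) = closure Ω

/-- `g` coincides on `A` with a polynomial of degree at most `l`. -/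
def IsPolyOn {d : ℕ} (l : ℕ) (A : Set (Vec d)) (g : Vec d → ℝ) : Prop :=
  ∃ P : MvPolynomial (Fin d) ℝ, P.totalDegree ≤ l ∧
    ∀ x ∈ A, g x = MvPolynomial.eval (fun j => x j) P

/-- The velocity space `X_h`: fields in `W_0^{1,p}(Ω)` that are polynomials of degree at most `k`
on each simplex and vanish on the boundary. Each field is represented by its continuous
representative, extended by zero. -/
def spaceX {d : ℕ} {Ω : Set (Vec d)} (𝒯 : Triangulation Ω) (p : ℝ) (k : ℕ) :
    Set (Vec d → Vec d) :=
  {v | MemW1pZero Ω p v ∧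
    (∀ T ∈ 𝒯.cells, ∀ i, IsPolyOn k (convexHull ℝ (T : Set (Vec d))) fun x => v x i) ∧
    ∀ x ∉ Ω, v x = 0}

/-- The pressure space `Y_h`: functions in `L^{p'}(Ω)`, `p' = p / (p - 1)`, that are polynomials
of degree at most `r` on each open simplex. -/
def spaceY {d : ℕ} {Ω : Set (Vec d)} (𝒯 : Triangulation Ω) (p : ℝ) (r : ℕ) :
    Set (Vec d → ℝ) :=
  {q | MemLp q (ENNReal.ofReal (p / (p - 1))) (volume.restrict Ω) ∧
    ∀ T ∈ 𝒯.cells, IsPolyOn r (interior (convexHull ℝ (T : Set (Vec d)))) q}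

/-- The space `V_h` of discretely divergence-free fields. -/
def spaceV {d : ℕ} {Ω : Set (Vec d)} (𝒯 : Triangulation Ω) (p : ℝ) (k r : ℕ) :
    Set (Vec d → Vec d) :=
  {v | v ∈ spaceX 𝒯 p k ∧ ∀ q ∈ spaceY 𝒯 p r, ∫ x in Ω, q x * weakDiv Ω v x = 0}

/-! ### The discrete problems -/

/-- `(u, v) = ∫_Ω u · v`. -/
def pairing {d : ℕ} {ι : Type*} [Fintype ι] (Ω : Set (Vec d))
    (u v : Vec d → EuclideanSpace ℝ ι) : ℝ :=
  ∫ x in Ω, inner ℝ (u x) (v x)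

/-- `(S(Du), Dξ)`. -/
def stressForm {d : ℕ} (Ω : Set (Vec d)) (p δ : ℝ) (u ξ : Vec d → Vec d) : ℝ :=
  pairing Ω (fun x => stress p δ (symGrad Ω u x)) (symGrad Ω ξ)

/-- `u₀ʰ ∈ V` is the discrete initial value: `(S(Du₀ʰ), Dξ) = (S(Du₀), Dξ)` for all `ξ ∈ V`. -/
def IsDiscreteInitialValue {d : ℕ} (Ω : Set (Vec d)) (p δ : ℝ) (V : Set (Vec d → Vec d))
    (u₀ u₀h : Vec d → Vec d) : Prop :=
  u₀h ∈ V ∧ ∀ ξ ∈ V, stressForm Ω p δ u₀h ξ = stressForm Ω p δ u₀ ξ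

/-- The curve `u` is in `C¹([0,T], V)` with derivative `u'`, where the space `V` of fields in
`W^{1,p}(Ω)` carries the norm of `W^{1,p}(Ω)`. -/
def IsC1Curve {d : ℕ} (Ω : Set (Vec d)) (p T : ℝ) (V : Set (Vec d → Vec d))
    (u u' : ℝ → Vec d → Vec d) : Prop :=
  ∀ t ∈ Icc 0 T, u t ∈ V ∧ u' t ∈ V ∧
    Tendsto (fun s => w1pNorm Ω p ((s - t)⁻¹ • (u s - u t) - u' t))
      (𝓝[Icc 0 T \ {t}] t) (𝓝 0) ∧
    Tendsto (fun s => w1pNorm Ω p (u' s - u' t)) (𝓝[Icc 0 T] t) (𝓝 0)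

/-- `u ∈ C¹([0,T], V)` solves the semi-discrete problem
`(∂_t u(t), ξ) + (S(Du(t)), Dξ) = (f(t), ξ)` for all `t ∈ [0,T]` and `ξ ∈ V`, `u(0) = u₀ʰ`. -/
def IsSemidiscreteSolution {d : ℕ} {Ω : Set (Vec d)} (p δ T : ℝ) (V : Set (Vec d → Vec d))
    (f : ℝ → L2Vec Ω) (u₀h : Vec d → Vec d) (u : ℝ → Vec d → Vec d) : Prop :=
  u 0 = u₀h ∧ ∃ u' : ℝ → Vec d → Vec d, IsC1Curve Ω p T V u u' ∧
    ∀ t ∈ Icc 0 T, ∀ ξ ∈ V,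
      pairing Ω (u' t) ξ + stressForm Ω p δ (u t) ξ = pairing Ω (f t) ξ

/-- The mean value of `f` over `I_n = (t_{n-1}, t_n)`, where `t_n = n τ`. -/
def timeMean {d : ℕ} {Ω : Set (Vec d)} (τ : ℝ) (f : ℝ → L2Vec Ω) (n : ℕ) : L2Vec Ω :=
  τ⁻¹ • ∫ s in (((n : ℝ) - 1) * τ)..((n : ℝ) * τ), f s

/-- `U⁰, …, U^M ∈ V` solves the implicit Euler scheme with step size `τ`, right-hand sides the
mean values of `f`, and `U⁰ = u₀ʰ`. -/
def IsEulerSolution {d : ℕ} {Ω : Set (Vec d)} (p δ τ : ℝ) (M : ℕ) (V : Set (Vec d → Vec d))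
    (f : ℝ → L2Vec Ω) (u₀h : Vec d → Vec d) (U : ℕ → Vec d → Vec d) : Prop :=
  U 0 = u₀h ∧ ∀ n ∈ Finset.Icc 1 M, U n ∈ V ∧ ∀ ξ ∈ V,
    pairing Ω (τ⁻¹ • (U n - U (n - 1))) ξ + stressForm Ω p δ (U n) ξ =
      pairing Ω (timeMean τ f n) ξ

end

end GenStokes

open GenStokes

/-!
The scheme is compared with the semidiscrete equation integrated over a time step, tested with the
error `e = u_h(t_n) - U^n`. With `S(Du)` and `F(Du)` as in the definitions, two pointwise facts carry
the argument, both with constants that depend on `p` only: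
`c |F(A) - F(B)|² ≤ (S(A) - S(B)) : (A - B)` (`exists_monotone_powerField`) and
`|S(A) - S(B)| |A - Z| ≤ ε |F(A) - F(Z)|² + C |F(A) - F(B)|²` (`exists_young_powerField`).
Both follow from two-sided bounds of the increments of `A ↦ (δ + |A|)^q A`, `q > -1`, with the
weight `(δ + max |A| |B|)^q`. Monotonicity bounds the error on the left-hand side; Young's inequality
reduces the consistency error on the step `I_n` to `‖F(Du_h(t_n)) - F(Du_h(s))‖²`, `s ∈ I_n`.

That quantity is of second order in the step size because `∂_t F(Du_h)` is bounded in
`L²((0,T), L²(Ω))`. The bound is used in the integrated form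
`c ‖F(Du_h(b)) - F(Du_h(a))‖² ≤ (b - a) (Ψ(b) - Ψ(a))` with a monotone `Ψ` (`exists_modulus`), which
requires no differentiability of `F`: one tests the difference of the equation at the times `t + h`
and `t` with `u_h(t + h) - u_h(t)`, integrates over `(a, b)`, divides by `h²` and lets `h → 0`. The
total increment of `Ψ` is controlled by the total variation of `f` and by `‖∂_t u_h(0)‖`. Summation
over the steps telescopes `Ψ`, so that the resulting bound (`euler_error`, stated for abstract
monotone problems) does not see the number of steps.

The norm `‖∂_t u_h(0)‖` is bounded independently of the discretization by the choice of the
discrete initial value: `(S(Du_0^h), Dξ) = (S(Du_0), Dξ) = -(div S(Du_0), ξ)`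
(`enorm_stressForm_le_lqNorm`). The integration by parts holds for test fields by definition of the
weak gradient, and extends to `W_0^{1,p}(Ω)` since this space embeds into `L²(Ω)` for
`p ≥ 2d/(d+2)` (`exists_lqNorm_le_w1pNorm`, from the Gagliardo-Nirenberg-Sobolev inequality). The
same embedding turns `C¹` curves in `W^{1,p}` into `C¹` curves in `L²`. Of the finite element space
only its linear structure and the inclusion `V_h ⊂ W_0^{1,p}(Ω)` are needed
(`galerkin_euler_error`).
-/

namespace GenStokes

noncomputable section

/-! ### Pointwise inequalities for the stress tensor -/

section PowerField

variable {E : Type*} [NormedAddCommGroup E] [InnerProductSpace ℝ E]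

/-- The radial field `A ↦ (δ + |A|)^q A`. On symmetric tensors, `q = p - 2` gives the stress `S`
and `q = (p - 2) / 2` gives `F`. -/
def powerField (δ q : ℝ) (A : E) : E := (δ + ‖A‖) ^ q • A

lemma abs_rpow_sub_rpow_mul_le {q r s : ℝ} (hq : -1 < q) (hr : 0 < r) (hrs : r ≤ s) :
    |s ^ q - r ^ q| * r ≤ (1 + |q|) * (s ^ q * (s - r)) := by
  have hs : 0 < s := hr.trans_le hrs
  have hsq : 0 < s ^ q := Real.rpow_pos_of_pos hs q
  have h0 : 0 ≤ s ^ q * (s - r) := mul_nonneg hsq.le (by linarith)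
  rcases le_or_gt 0 q with h | h
  · have hle : r ^ q ≤ s ^ q := Real.rpow_le_rpow hr.le hrs h
    rw [abs_of_nonneg (by linarith), abs_of_nonneg h]
    have hb := one_add_mul_self_le_rpow_one_add (s := r / s - 1) (p := 1 + q)
      (by have : 0 ≤ r / s := by positivity
          linarith) (by linarith)
    have e1 : (1 + (r / s - 1)) ^ (1 + q) = r * r ^ q / (s * s ^ q) := by
      rw [show 1 + (r / s - 1) = r / s by ring, Real.div_rpow hr.le hs.le, Real.rpow_add hr,
        Real.rpow_add hs, Real.rpow_one, Real.rpow_one]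
    rw [e1, le_div_iff₀ (by positivity)] at hb
    have e2 : (1 + (1 + q) * (r / s - 1)) * (s * s ^ q) = (s + (1 + q) * (r - s)) * s ^ q := by
      field_simp
    rw [e2] at hb
    nlinarith
  · have hle : s ^ q ≤ r ^ q := Real.rpow_le_rpow_of_nonpos hr hrs h.le
    rw [abs_of_nonpos (by linarith)]
    have h1 : r ^ q * r ≤ s ^ q * s := by
      rw [← Real.rpow_add_one hr.ne', ← Real.rpow_add_one hs.ne']
      exact Real.rpow_le_rpow hr.le hrs (by linarith)
    nlinarith [abs_nonneg q]

lemma norm_powerField_sub_le_of_le {δ q : ℝ} (hδ : 0 ≤ δ) (hq : -1 < q) {A B : E}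
    (hAB : ‖B‖ ≤ ‖A‖) :
    ‖powerField δ q A - powerField δ q B‖ ≤ (2 + |q|) * ((δ + ‖A‖) ^ q * ‖A - B‖) := by
  have hα : 0 ≤ (δ + ‖A‖) ^ q := by positivity
  have e : powerField δ q A - powerField δ q B =
      (δ + ‖A‖) ^ q • (A - B) + ((δ + ‖A‖) ^ q - (δ + ‖B‖) ^ q) • B := by
    simp only [powerField, smul_sub, sub_smul]
    abel
  have key : |(δ + ‖A‖) ^ q - (δ + ‖B‖) ^ q| * ‖B‖ ≤
      (1 + |q|) * ((δ + ‖A‖) ^ q * ‖A - B‖) := by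
    rcases eq_or_ne B 0 with rfl | hB
    · simp only [norm_zero, mul_zero]
      positivity
    · have hBp : 0 < ‖B‖ := norm_pos_iff.2 hB
      have h := abs_rpow_sub_rpow_mul_le hq (r := δ + ‖B‖) (s := δ + ‖A‖) (by linarith)
        (by linarith)
      have h2 : ‖A‖ - ‖B‖ ≤ ‖A - B‖ := norm_sub_norm_le A B
      calc _ ≤ |(δ + ‖A‖) ^ q - (δ + ‖B‖) ^ q| * (δ + ‖B‖) := by gcongr; linarith
        _ ≤ _ := h
        _ ≤ _ := by gcongr; linarith
  rw [e]
  refine (norm_add_le _ _).trans ?_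
  rw [norm_smul, norm_smul, Real.norm_eq_abs, Real.norm_eq_abs, abs_of_nonneg hα]
  linarith

/-- Local Lipschitz bound for `powerField`, with the degenerate weight `(δ + max |A| |B|)^q`. -/
lemma norm_powerField_sub_le {δ q : ℝ} (hδ : 0 ≤ δ) (hq : -1 < q) (A B : E) :
    ‖powerField δ q A - powerField δ q B‖ ≤
      (2 + |q|) * ((δ + max ‖A‖ ‖B‖) ^ q * ‖A - B‖) := by
  rcases le_total ‖B‖ ‖A‖ with h | h
  · rw [max_eq_left h]
    exact norm_powerField_sub_le_of_le hδ hq h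
  · rw [max_eq_right h, norm_sub_rev, norm_sub_rev A]
    exact norm_powerField_sub_le_of_le hδ hq h

lemma le_inner_powerField_sub_of_le {δ q : ℝ} (hδ : 0 ≤ δ) (hq : -1 < q) {A B : E}
    (hAB : ‖B‖ ≤ ‖A‖) :
    min (1 / 2) (1 + q) * ((δ + ‖A‖) ^ q * ‖A - B‖ ^ 2) ≤
      inner ℝ (powerField δ q A - powerField δ q B) (A - B) := by
  have hκ : min (1 / 2) (1 + q) ≤ 1 / 2 := min_le_left _ _
  have hκ' : min (1 / 2) (1 + q) ≤ 1 + q := min_le_right _ _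
  have hα : 0 ≤ (δ + ‖A‖) ^ q := by positivity
  have hβ : 0 ≤ (δ + ‖B‖) ^ q := by positivity
  -- `B = 0` is separate: for `δ = 0` and `q < 0` the weight `0 ^ q` has the junk value `0`.
  rcases eq_or_ne B 0 with rfl | hB
  · have : 0 ≤ (δ + ‖A‖) ^ q * ‖A‖ ^ 2 := by positivity
    simp only [powerField, smul_zero, sub_zero, inner_smul_left, real_inner_self_eq_norm_sq]
    simp only [conj_trivial]
    nlinarith
  have hBp : 0 < ‖B‖ := norm_pos_iff.2 hB
  set α := (δ + ‖A‖) ^ q with hαd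
  set β := (δ + ‖B‖) ^ q with hβd
  set D := ‖A - B‖ with hD
  have hD2 : D ^ 2 = ‖A‖ ^ 2 - 2 * inner ℝ A B + ‖B‖ ^ 2 := norm_sub_sq_real A B
  have hDge : ‖A‖ - ‖B‖ ≤ D := norm_sub_norm_le A B
  have e : inner ℝ (powerField δ q A - powerField δ q B) (A - B) =
      (α + β) / 2 * D ^ 2 + (α - β) * (‖A‖ ^ 2 - ‖B‖ ^ 2) / 2 := by
    simp only [powerField, inner_sub_left, inner_sub_right, inner_smul_left,
      real_inner_self_eq_norm_sq, conj_trivial, real_inner_comm A B]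
    rw [hD2]
    ring
  rw [e]
  have hsq : ‖B‖ ^ 2 ≤ ‖A‖ ^ 2 := by gcongr
  rcases le_or_gt 0 q with h | h
  · have hle : β ≤ α := Real.rpow_le_rpow (by positivity) (by linarith) h
    have h1 : 0 ≤ (α - β) * (‖A‖ ^ 2 - ‖B‖ ^ 2) := mul_nonneg (by linarith) (by linarith)
    have h2 : 0 ≤ α * D ^ 2 := by positivity
    have h3 : 0 ≤ β * D ^ 2 := by positivity
    nlinarith
  · have hr : 0 < δ + ‖B‖ := by positivity
    have hs : 0 < δ + ‖A‖ := by linarith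
    have hle : α ≤ β := Real.rpow_le_rpow_of_nonpos hr (by linarith) h.le
    -- After dividing by `α`, this is Bernoulli's inequality for the exponent `-q ∈ (0, 1)`.
    have key : (1 + q) * (α * (‖A‖ - ‖B‖)) ≤ α * ‖A‖ - β * ‖B‖ := by
      have hb := rpow_one_add_le_one_add_mul_self (s := (δ + ‖A‖) / (δ + ‖B‖) - 1) (p := -q)
        (by have : 0 ≤ (δ + ‖A‖) / (δ + ‖B‖) := by positivity
            linarith) (by linarith) (by linarith)
      have e1 : (1 + ((δ + ‖A‖) / (δ + ‖B‖) - 1)) ^ (-q) = β / α := by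
        rw [show 1 + ((δ + ‖A‖) / (δ + ‖B‖) - 1) = (δ + ‖A‖) / (δ + ‖B‖) by ring,
          Real.div_rpow hs.le hr.le, Real.rpow_neg hs.le, Real.rpow_neg hr.le, inv_div_inv]
      have hαp : 0 < α := Real.rpow_pos_of_pos hs q
      rw [e1, div_le_iff₀ hαp] at hb
      have h4 : ((δ + ‖A‖) / (δ + ‖B‖) - 1) * ‖B‖ ≤ ‖A‖ - ‖B‖ := by
        rw [div_sub_one hr.ne', div_mul_eq_mul_div, div_le_iff₀ hr]
        nlinarith
      have h5 : β * ‖B‖ ≤ (1 + -q * ((δ + ‖A‖) / (δ + ‖B‖) - 1)) * α * ‖B‖ := by gcongr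
      have h6 : (-q) * α * (((δ + ‖A‖) / (δ + ‖B‖) - 1) * ‖B‖) ≤ (-q) * α * (‖A‖ - ‖B‖) :=
        mul_le_mul_of_nonneg_left h4 (mul_nonneg (by linarith) hα)
      nlinarith
    -- The claim is affine and increasing in `D²`, so that `D = |A| - |B|` is the extreme case.
    have h7 : (‖A‖ - ‖B‖) ^ 2 ≤ D ^ 2 := by gcongr
    have h8 : 0 ≤ (α + β) / 2 - min (1 / 2) (1 + q) * α := by nlinarith
    have h9 := mul_le_mul_of_nonneg_left h7 h8
    have h10 : min (1 / 2) (1 + q) * (α * (‖A‖ - ‖B‖)) ≤ (1 + q) * (α * (‖A‖ - ‖B‖)) := by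
      gcongr
    have h11 := mul_le_mul_of_nonneg_right (h10.trans key) (sub_nonneg.2 hAB)
    nlinarith

/-- Monotonicity of `powerField`, with the degenerate weight `(δ + max |A| |B|)^q`. -/
lemma le_inner_powerField_sub {δ q : ℝ} (hδ : 0 ≤ δ) (hq : -1 < q) (A B : E) :
    min (1 / 2) (1 + q) * ((δ + max ‖A‖ ‖B‖) ^ q * ‖A - B‖ ^ 2) ≤
      inner ℝ (powerField δ q A - powerField δ q B) (A - B) := by
  rcases le_total ‖B‖ ‖A‖ with h | h
  · rw [max_eq_left h]
    exact le_inner_powerField_sub_of_le hδ hq h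
  · rw [max_eq_right h, norm_sub_rev, ← inner_neg_neg, neg_sub, neg_sub]
    exact le_inner_powerField_sub_of_le hδ hq h

lemma sq_rpow_half {m p : ℝ} (hm : 0 ≤ m) : (m ^ ((p - 2) / 2)) ^ 2 = m ^ (p - 2) := by
  rw [← Real.rpow_natCast, ← Real.rpow_mul hm]
  congr 1
  push_cast
  ring

/-- `|F(A) - F(B)|²` is controlled by `(δ + max |A| |B|)^(p - 2) |A - B|²`. -/
lemma norm_powerField_half_sub_sq_le {p δ : ℝ} (hp : 1 < p) (hδ : 0 ≤ δ) (A B : E) :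
    ‖powerField δ ((p - 2) / 2) A - powerField δ ((p - 2) / 2) B‖ ^ 2 ≤
      (2 + |(p - 2) / 2|) ^ 2 * ((δ + max ‖A‖ ‖B‖) ^ (p - 2) * ‖A - B‖ ^ 2) := by
  have h := norm_powerField_sub_le hδ (q := (p - 2) / 2) (by linarith) A B
  have h2 := pow_le_pow_left₀ (norm_nonneg _) h 2
  have hm : 0 ≤ δ + max ‖A‖ ‖B‖ := by positivity
  rwa [mul_pow, mul_pow, sq_rpow_half hm] at h2

/-- `|F(A) - F(B)|²` controls `(δ + max |A| |B|)^(p - 2) |A - B|²`. -/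
lemma le_norm_powerField_half_sub_sq {p δ : ℝ} (hp : 1 < p) (hδ : 0 ≤ δ) (A B : E) :
    (1 / 4) * ((δ + max ‖A‖ ‖B‖) ^ (p - 2) * ‖A - B‖ ^ 2) ≤
      ‖powerField δ ((p - 2) / 2) A - powerField δ ((p - 2) / 2) B‖ ^ 2 := by
  have h := le_inner_powerField_sub hδ (q := (p - 2) / 2) (by linarith) A B
  rw [min_eq_left (by linarith)] at h
  have h1 := h.trans (real_inner_le_norm _ _)
  have hm : 0 ≤ δ + max ‖A‖ ‖B‖ := by positivity
  have h2 : 1 / 2 * ((δ + max ‖A‖ ‖B‖) ^ ((p - 2) / 2) * ‖A - B‖) ≤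
      ‖powerField δ ((p - 2) / 2) A - powerField δ ((p - 2) / 2) B‖ := by
    rcases eq_or_lt_of_le (norm_nonneg (A - B)) with h0 | h0
    · rw [← h0]
      simp
    · refine le_of_mul_le_mul_right ?_ h0
      linarith
  have h3 := pow_le_pow_left₀ (by positivity) h2 2
  rw [mul_pow, mul_pow, sq_rpow_half hm] at h3
  linarith

/-- The natural distance is controlled by the monotonicity of the stress:
`c |F(A) - F(B)|² ≤ (S(A) - S(B)) : (A - B)`. -/
lemma exists_monotone_powerField {p : ℝ} (hp : 1 < p) :
    ∃ c : ℝ, 0 < c ∧ ∀ δ : ℝ, 0 ≤ δ → ∀ A B : E,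
      c * ‖powerField δ ((p - 2) / 2) A - powerField δ ((p - 2) / 2) B‖ ^ 2 ≤
        inner ℝ (powerField δ (p - 2) A - powerField δ (p - 2) B) (A - B) := by
  have hκ : 0 < min (1 / 2 : ℝ) (1 + (p - 2)) := lt_min (by norm_num) (by linarith)
  have hC : 0 < (2 + |(p - 2) / 2|) ^ 2 := by positivity
  refine ⟨min (1 / 2) (1 + (p - 2)) / (2 + |(p - 2) / 2|) ^ 2, by positivity,
    fun δ hδ A B => ?_⟩
  refine le_trans ?_ (le_inner_powerField_sub hδ (by linarith) A B)
  rw [div_mul_eq_mul_div, div_le_iff₀ hC, mul_assoc]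
  gcongr
  rw [mul_comm _ ((2 + |(p - 2) / 2|) ^ 2)]
  exact norm_powerField_half_sub_sq_le hp hδ A B

/-- Far-away case of the Young inequality: the weighted distance `(δ + max |A| |B|)^(p - 2) |A - B|`
gains a factor `k^(-min(1, p - 1))` over that of a point `k` times farther away. -/
lemma rpow_mul_norm_le_of_mul_le {E : Type*} [NormedAddCommGroup E] {p δ k : ℝ} (hp : 1 < p)
    (hδ : 0 ≤ δ) (hk : 1 ≤ k) {A B Z : E}
    (hfar : k * ‖A - B‖ ≤ ‖A - Z‖) :
    (δ + max ‖A‖ ‖B‖) ^ (p - 2) * ‖A - B‖ ≤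
      3 ^ |p - 2| * k ^ (-min 1 (p - 1)) *
        ((δ + max ‖A‖ ‖Z‖) ^ (p - 2) * ‖A - Z‖) := by
  have hk0 : 0 < k := by linarith
  rcases eq_or_lt_of_le (norm_nonneg (A - B)) with h0 | hx
  · rw [← h0, mul_zero]
    positivity
  set x := ‖A - B‖ with hxd
  set y := ‖A - Z‖ with hyd
  set m := δ + max ‖A‖ ‖B‖ with hm
  set n := δ + max ‖A‖ ‖Z‖ with hn
  have hxy : x ≤ y := by nlinarith
  have hy : 0 < y := hx.trans_le hxy
  have hxm : x ≤ 2 * m := by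
    have := norm_sub_le A B
    have h1 := le_max_left ‖A‖ ‖B‖
    have h2 := le_max_right ‖A‖ ‖B‖
    linarith
  have hyn : y ≤ 2 * n := by
    have := norm_sub_le A Z
    have h1 := le_max_left ‖A‖ ‖Z‖
    have h2 := le_max_right ‖A‖ ‖Z‖
    linarith
  have hm0 : 0 < m := by linarith
  have hn0 : 0 < n := by linarith
  rcases le_or_gt 2 p with h | h
  · rw [min_eq_left (by linarith), abs_of_nonneg (by linarith), Real.rpow_neg_one]
    have hmn : m ≤ 3 * n := by
      have h1 := le_max_left ‖A‖ ‖Z‖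
      have h3 : ‖B‖ ≤ ‖A‖ + x := by
        have := norm_sub_norm_le B A
        rw [norm_sub_rev] at this
        linarith
      have h4 : max ‖A‖ ‖B‖ ≤ ‖A‖ + x := max_le (by linarith) h3
      linarith
    calc m ^ (p - 2) * x ≤ (3 * n) ^ (p - 2) * (k⁻¹ * y) := by
          have h5 : x ≤ k⁻¹ * y := by rwa [inv_mul_eq_div, le_div_iff₀ hk0, mul_comm]
          have h6 : m ^ (p - 2) ≤ (3 * n) ^ (p - 2) :=
            Real.rpow_le_rpow hm0.le hmn (by linarith)
          gcongr
      _ = _ := by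
          rw [Real.mul_rpow (by norm_num) hn0.le]
          ring
  · rw [min_eq_right (by linarith), abs_of_nonpos (by linarith)]
    have hnm : n ≤ 3 * (y / x) * m := by
      have h3 : ‖Z‖ ≤ ‖A‖ + y := by
        have := norm_sub_norm_le Z A
        rw [norm_sub_rev] at this
        linarith
      have h1 := le_max_left ‖A‖ ‖B‖
      have h4 : max ‖A‖ ‖Z‖ ≤ ‖A‖ + y := max_le (by linarith) h3
      have h5 : n ≤ m + y := by linarith
      have h6 : 1 ≤ y / x := (one_le_div hx).2 hxy
      have h7 : y ≤ 2 * (y / x) * m := by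
        rw [show 2 * (y / x) * m = y * (2 * m) / x by ring, le_div_iff₀ hx]
        gcongr
      nlinarith
    have h8 : n ^ (2 - p) ≤ 3 ^ (2 - p) * (y / x) ^ (2 - p) * m ^ (2 - p) := by
      rw [← Real.mul_rpow (by norm_num) (by positivity),
        ← Real.mul_rpow (by positivity) hm0.le]
      exact Real.rpow_le_rpow hn0.le hnm (by linarith)
    have h9 : m ^ (p - 2) ≤ 3 ^ (2 - p) * (y / x) ^ (2 - p) * n ^ (p - 2) := by
      have e1 : m ^ (p - 2) = (m ^ (2 - p))⁻¹ := by
        rw [← Real.rpow_neg hm0.le]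
        congr 1
        ring
      have e2 : n ^ (p - 2) = (n ^ (2 - p))⁻¹ := by
        rw [← Real.rpow_neg hn0.le]
        congr 1
        ring
      have hmp : 0 < m ^ (2 - p) := by positivity
      have hnp : 0 < n ^ (2 - p) := by positivity
      rw [e1, e2, ← div_eq_mul_inv, le_div_iff₀ hnp, inv_mul_eq_div, div_le_iff₀ hmp]
      exact h8
    have h10 : (y / x) ^ (2 - p) * x ≤ k ^ (-(p - 1)) * y := by
      have h11 : k ≤ y / x := (le_div_iff₀ hx).2 hfar
      have h12 : (y / x) ^ (-(p - 1)) ≤ k ^ (-(p - 1)) :=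
        Real.rpow_le_rpow_of_nonpos hk0 h11 (by linarith)
      have e3 : (y / x) ^ (2 - p) * x = (y / x) ^ (-(p - 1)) * y := by
        rw [show 2 - p = -(p - 1) + 1 by ring, Real.rpow_add_one (by positivity)]
        field_simp
      rw [e3]
      gcongr
    calc m ^ (p - 2) * x ≤ 3 ^ (2 - p) * (y / x) ^ (2 - p) * n ^ (p - 2) * x := by gcongr
      _ = 3 ^ (2 - p) * n ^ (p - 2) * ((y / x) ^ (2 - p) * x) := by ring
      _ ≤ 3 ^ (2 - p) * n ^ (p - 2) * (k ^ (-(p - 1)) * y) := by gcongr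
      _ = _ := by
        rw [show -(p - 2) = 2 - p by ring]
        ring

/-- Young's inequality for the stress:
`|S(A) - S(B)| |A - Z| ≤ ε |F(A) - F(Z)|² + C_ε |F(A) - F(B)|²`, uniformly in `δ`. -/
lemma exists_young_powerField {p : ℝ} (hp : 1 < p) {ε : ℝ} (hε : 0 < ε) :
    ∃ C : ℝ, 0 ≤ C ∧ ∀ δ : ℝ, 0 ≤ δ → ∀ A B Z : E,
      ‖powerField δ (p - 2) A - powerField δ (p - 2) B‖ * ‖A - Z‖ ≤
        ε * ‖powerField δ ((p - 2) / 2) A - powerField δ ((p - 2) / 2) Z‖ ^ 2 +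
        C * ‖powerField δ ((p - 2) / 2) A - powerField δ ((p - 2) / 2) B‖ ^ 2 := by
  set L : ℝ := 2 + |p - 2| with hL
  have hL0 : 0 < L := by positivity
  have hθ : 0 < min 1 (p - 1) := lt_min one_pos (by linarith)
  -- `k` separates the near case `|A - Z| ≤ k |A - B|`, absorbed by the second term, from the far
  -- case, where the gain of `rpow_mul_norm_le_of_mul_le` provides the factor `ε`.
  obtain ⟨k, hk1, hk⟩ : ∃ k : ℝ, 1 ≤ k ∧ L * (3 ^ |p - 2| * k ^ (-min 1 (p - 1))) ≤ ε / 4 := by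
    have ht : Tendsto (fun k : ℝ => L * (3 ^ |p - 2| * k ^ (-min 1 (p - 1)))) atTop
        (𝓝 (L * (3 ^ |p - 2| * 0))) :=
      ((tendsto_rpow_neg_atTop hθ).const_mul _).const_mul _
    rw [mul_zero, mul_zero] at ht
    exact ((eventually_ge_atTop 1).and (ht.eventually_le_const (by positivity))).exists
  refine ⟨4 * L * k, by positivity, fun δ hδ A B Z => ?_⟩
  have h1 := norm_powerField_sub_le hδ (q := p - 2) (by linarith) A B
  have hB := le_norm_powerField_half_sub_sq hp hδ A B
  have hZ := le_norm_powerField_half_sub_sq hp hδ A Z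
  set FB := ‖powerField δ ((p - 2) / 2) A - powerField δ ((p - 2) / 2) B‖ ^ 2
  set FZ := ‖powerField δ ((p - 2) / 2) A - powerField δ ((p - 2) / 2) Z‖ ^ 2
  have hFB : 0 ≤ FB := sq_nonneg _
  have hFZ : 0 ≤ FZ := sq_nonneg _
  have h2 := mul_le_mul_of_nonneg_right h1 (norm_nonneg (A - Z))
  refine h2.trans ?_
  set m := (δ + max ‖A‖ ‖B‖) ^ (p - 2) with hm
  have hm0 : 0 ≤ m := by positivity
  rcases le_total ‖A - Z‖ (k * ‖A - B‖) with h | h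
  · have h3 : L * (m * ‖A - B‖) * ‖A - Z‖ ≤ L * (m * ‖A - B‖) * (k * ‖A - B‖) := by gcongr
    have h4 : L * (m * ‖A - B‖) * (k * ‖A - B‖) = L * k * (m * ‖A - B‖ ^ 2) := by ring
    have h5 : L * k * (m * ‖A - B‖ ^ 2) ≤ L * k * (4 * FB) :=
      mul_le_mul_of_nonneg_left (by linarith) (by positivity)
    have h6 : 0 ≤ ε * FZ := by positivity
    linarith
  · have h3 := rpow_mul_norm_le_of_mul_le hp hδ hk1 h
    set n := (δ + max ‖A‖ ‖Z‖) ^ (p - 2) with hn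
    have hn0 : 0 ≤ n := by positivity
    have h4 : L * (m * ‖A - B‖) * ‖A - Z‖ ≤
        L * (3 ^ |p - 2| * k ^ (-min 1 (p - 1)) * (n * ‖A - Z‖)) * ‖A - Z‖ := by gcongr
    have h5 : L * (3 ^ |p - 2| * k ^ (-min 1 (p - 1)) * (n * ‖A - Z‖)) * ‖A - Z‖ =
        L * (3 ^ |p - 2| * k ^ (-min 1 (p - 1))) * (n * ‖A - Z‖ ^ 2) := by ring
    have h6 : L * (3 ^ |p - 2| * k ^ (-min 1 (p - 1))) * (n * ‖A - Z‖ ^ 2) ≤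
        ε / 4 * (4 * FZ) :=
      mul_le_mul hk (by linarith) (by positivity) (by positivity)
    have h7 : 0 ≤ 4 * L * k * FB := by positivity
    linarith

end PowerField

/-! ### Time regularity of monotone evolutions -/

/-- The Cauchy-Schwarz inequality `‖x‖_{L¹}² ≤ (b - a) ‖x‖_{L²}²`, from the nonnegativity of the
variance of `‖x‖`. -/
lemma sq_integral_norm_le {K : Type*} [NormedAddCommGroup K] {a b : ℝ} (hab : a < b)
    {x : ℝ → K} (hx : Continuous x) :
    (∫ t in a..b, ‖x t‖) ^ 2 ≤ (b - a) * ∫ t in a..b, ‖x t‖ ^ 2 := by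
  have hba : 0 < b - a := sub_pos.2 hab
  set I := ∫ t in a..b, ‖x t‖
  set μ := I / (b - a) with hμ
  have h0 : 0 ≤ ∫ t in a..b, (‖x t‖ - μ) ^ 2 :=
    intervalIntegral.integral_nonneg hab.le fun t _ => sq_nonneg _
  have e : ∫ t in a..b, (‖x t‖ - μ) ^ 2 =
      (∫ t in a..b, ‖x t‖ ^ 2) - 2 * μ * I + μ ^ 2 * (b - a) := by
    have e1 : ∀ t, (‖x t‖ - μ) ^ 2 = ‖x t‖ ^ 2 - 2 * μ * ‖x t‖ + μ ^ 2 := fun t => by ring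
    simp_rw [e1]
    rw [intervalIntegral.integral_add, intervalIntegral.integral_sub,
      intervalIntegral.integral_const_mul, intervalIntegral.integral_const, smul_eq_mul,
      mul_comm (b - a)]
    all_goals exact Continuous.intervalIntegrable (by fun_prop) _ _
  rw [e] at h0
  have hμI : μ * (b - a) = I := by
    rw [hμ]
    field_simp
  have h1 : μ ^ 2 * (b - a) = μ * I := by rw [pow_two, mul_assoc, hμI]
  have h2 : μ * I ≤ ∫ t in a..b, ‖x t‖ ^ 2 := by linarith
  calc I ^ 2 = (b - a) * (μ * I) := by
        rw [← hμI]
        ring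
    _ ≤ _ := by gcongr

lemma tendsto_integral_diffQuot {K : Type*} [NormedAddCommGroup K] [NormedSpace ℝ K]
    [CompleteSpace K] {g : ℝ → K} (hg : Continuous g) (a b : ℝ) :
    Tendsto (fun h : ℝ => h⁻¹ • ∫ t in a..b, (g (t + h) - g t)) (𝓝[>] 0) (𝓝 (g b - g a)) := by
  have hd : ∀ x : ℝ, Tendsto (fun h : ℝ => h⁻¹ • ((∫ t in a..(x + h), g t) - ∫ t in a..x, g t))
      (𝓝[>] 0) (𝓝 (g x)) := fun x =>
    (intervalIntegral.integral_hasDerivAt_right (hg.intervalIntegrable _ _)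
      hg.stronglyMeasurable.stronglyMeasurableAtFilter hg.continuousAt).tendsto_slope_zero_right
  refine ((hd b).sub (hd a)).congr fun h => ?_
  rw [← smul_sub]
  congr 1
  rw [intervalIntegral.integral_sub (Continuous.intervalIntegrable (by fun_prop) _ _)
    (hg.intervalIntegrable _ _), intervalIntegral.integral_comp_add_right,
    ← intervalIntegral.integral_add_adjacent_intervals (hg.intervalIntegrable a (a + h))
      (hg.intervalIntegrable (a + h) (b + h)), intervalIntegral.integral_same]
  abel

/-- A bound for the difference quotients in `L²(a, b)` bounds the increment over `(a, b)`. -/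
lemma mul_norm_sub_sq_le_of_integral_le {K : Type*} [NormedAddCommGroup K] [NormedSpace ℝ K]
    [CompleteSpace K] {g : ℝ → K} (hg : Continuous g) {a b c R₀ : ℝ} (hab : a < b) (hc : 0 ≤ c)
    {R : ℝ → ℝ} (hR : Tendsto R (𝓝[>] 0) (𝓝 R₀))
    (h : ∀ᶠ h in 𝓝[>] (0 : ℝ), c * ∫ t in a..b, ‖g (t + h) - g t‖ ^ 2 ≤ h ^ 2 * R h) :
    c * ‖g b - g a‖ ^ 2 ≤ (b - a) * R₀ := by
  have h1 := ((tendsto_integral_diffQuot hg a b).norm.pow 2).const_mul c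
  refine le_of_tendsto_of_tendsto h1 (hR.const_mul (b - a)) ?_
  filter_upwards [h, self_mem_nhdsWithin] with τ hτ (hτ0 : 0 < τ)
  have hcont : Continuous fun t => g (t + τ) - g t := by fun_prop
  have h2 : ‖∫ t in a..b, (g (t + τ) - g t)‖ ^ 2 ≤
      (b - a) * ∫ t in a..b, ‖g (t + τ) - g t‖ ^ 2 :=
    (pow_le_pow_left₀ (norm_nonneg _) (intervalIntegral.norm_integral_le_integral_norm hab.le)
      2).trans (sq_integral_norm_le hab hcont)
  rw [norm_smul, mul_pow, norm_inv, Real.norm_eq_abs, inv_pow, sq_abs]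
  have hba : 0 ≤ b - a := by linarith
  calc c * ((τ ^ 2)⁻¹ * ‖∫ t in a..b, (g (t + τ) - g t)‖ ^ 2)
      ≤ c * ((τ ^ 2)⁻¹ * ((b - a) * ∫ t in a..b, ‖g (t + τ) - g t‖ ^ 2)) := by gcongr
    _ = (b - a) * ((τ ^ 2)⁻¹ * (c * ∫ t in a..b, ‖g (t + τ) - g t‖ ^ 2)) := by ring
    _ ≤ (b - a) * ((τ ^ 2)⁻¹ * (τ ^ 2 * R τ)) := by gcongr
    _ = (b - a) * R τ := by field_simp

section Energy

variable {H K : Type*} [NormedAddCommGroup H] [InnerProductSpace ℝ H] [NormedAddCommGroup K]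
  [NormedSpace ℝ K] [CompleteSpace K]

lemma mul_norm_sub_sq_le_energy_of_lt {T c L a b : ℝ} (hc : 0 < c) {u u' f : ℝ → H} {g : ℝ → K}
    {Φ : ℝ → ℝ} (hu : ∀ t, HasDerivAt u (u' t) t) (hu' : Continuous u') (hg : Continuous g)
    (hΦ : Continuous Φ) (hL : ∀ t ∈ Icc 0 T, ‖u' t‖ ≤ L)
    (hf : ∀ s ∈ Icc 0 T, ∀ t ∈ Icc 0 T, s ≤ t → ‖f t - f s‖ ≤ Φ t - Φ s)
    (hmono : ∀ s ∈ Icc 0 T, ∀ t ∈ Icc 0 T,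
      c * ‖g t - g s‖ ^ 2 + inner ℝ (u' t - u' s) (u t - u s) ≤ inner ℝ (f t - f s) (u t - u s))
    (ha : 0 ≤ a) (hab : a < b) (hbT : b < T) :
    c * ‖g b - g a‖ ^ 2 ≤
      (b - a) * (‖u' a‖ ^ 2 / 2 - ‖u' b‖ ^ 2 / 2 + L * (Φ b - Φ a)) := by
  have hucont : Continuous u := continuous_iff_continuousAt.2 fun t => (hu t).continuousAt
  refine mul_norm_sub_sq_le_of_integral_le hg hab hc.le (R := fun h =>
    ‖h⁻¹ • (u (a + h) - u a)‖ ^ 2 / 2 - ‖h⁻¹ • (u (b + h) - u b)‖ ^ 2 / 2 +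
      L * (h⁻¹ • ∫ t in a..b, (Φ (t + h) - Φ t))) ?_ ?_
  · exact ((((hu a).tendsto_slope_zero_right.norm.pow 2).div_const 2).sub
      (((hu b).tendsto_slope_zero_right.norm.pow 2).div_const 2)).add
      ((tendsto_integral_diffQuot hΦ a b).const_mul L)
  have hsmall : ∀ᶠ h in 𝓝[>] (0 : ℝ), h < T - b :=
    (eventually_lt_nhds (by linarith)).filter_mono nhdsWithin_le_nhds
  filter_upwards [hsmall, self_mem_nhdsWithin] with h hhT (hh : 0 < h)
  have hpt : ∀ t ∈ Icc a b, c * ‖g (t + h) - g t‖ ^ 2 ≤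
      L * h * (Φ (t + h) - Φ t) - inner ℝ (u (t + h) - u t) (u' (t + h) - u' t) := by
    intro t ht
    have h1 : t ∈ Icc 0 T := ⟨by linarith [ht.1], by linarith [ht.2]⟩
    have h2 : t + h ∈ Icc 0 T := ⟨by linarith [ht.1], by linarith [ht.2]⟩
    have h3 := hmono t h1 (t + h) h2
    have h4 := hf t h1 (t + h) h2 (by linarith)
    have h5 : ‖u (t + h) - u t‖ ≤ L * h := by
      have := (convex_Icc (0 : ℝ) T).norm_image_sub_le_of_norm_hasDerivWithin_le
        (fun x _ => (hu x).hasDerivWithinAt) hL h1 h2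
      simpa [abs_of_pos hh] using this
    have h6 := real_inner_le_norm (f (t + h) - f t) (u (t + h) - u t)
    have h7 : ‖f (t + h) - f t‖ * ‖u (t + h) - u t‖ ≤ (Φ (t + h) - Φ t) * (L * h) := by
      gcongr
      exact (norm_nonneg _).trans h4
    rw [real_inner_comm] at h3
    linarith
  have hint : ∫ t in a..b, inner ℝ (u (t + h) - u t) (u' (t + h) - u' t) =
      ‖u (b + h) - u b‖ ^ 2 / 2 - ‖u (a + h) - u a‖ ^ 2 / 2 := by
    refine intervalIntegral.integral_eq_sub_of_hasDerivAt
      (f := fun t => ‖u (t + h) - u t‖ ^ 2 / 2) (fun t _ => ?_)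
      (Continuous.intervalIntegrable (by fun_prop) _ _)
    have h1 := (((hu (t + h)).comp_add_const t h).sub (hu t)).norm_sq.div_const 2
    rw [mul_div_cancel_left₀ _ two_ne_zero] at h1
    exact h1
  have hI := intervalIntegral.integral_mono_on (μ := volume) hab.le
    (Continuous.intervalIntegrable (by fun_prop) _ _)
    (Continuous.intervalIntegrable (by fun_prop) _ _) hpt
  rw [intervalIntegral.integral_const_mul, intervalIntegral.integral_sub
    (Continuous.intervalIntegrable (by fun_prop) _ _)
    (Continuous.intervalIntegrable (by fun_prop) _ _), hint,
    intervalIntegral.integral_const_mul] at hI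
  refine hI.trans (le_of_eq ?_)
  simp only [norm_smul, norm_inv, Real.norm_eq_abs, mul_pow, inv_pow, sq_abs, smul_eq_mul]
  field_simp
  ring

/-- The energy estimate for the time derivative in integrated form: it comes from testing the
difference of the equation at two times with the difference quotient of `u`, and letting the
increment tend to zero. -/
lemma mul_norm_sub_sq_le_energy {T c L a b : ℝ} (hc : 0 < c) {u u' f : ℝ → H} {g : ℝ → K}
    {Φ : ℝ → ℝ} (hu : ∀ t, HasDerivAt u (u' t) t) (hu' : Continuous u') (hg : Continuous g)
    (hΦ : Continuous Φ) (hL : ∀ t ∈ Icc 0 T, ‖u' t‖ ≤ L)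
    (hf : ∀ s ∈ Icc 0 T, ∀ t ∈ Icc 0 T, s ≤ t → ‖f t - f s‖ ≤ Φ t - Φ s)
    (hmono : ∀ s ∈ Icc 0 T, ∀ t ∈ Icc 0 T,
      c * ‖g t - g s‖ ^ 2 + inner ℝ (u' t - u' s) (u t - u s) ≤ inner ℝ (f t - f s) (u t - u s))
    (ha : 0 ≤ a) (hab : a ≤ b) (hbT : b ≤ T) :
    c * ‖g b - g a‖ ^ 2 ≤
      (b - a) * (‖u' a‖ ^ 2 / 2 - ‖u' b‖ ^ 2 / 2 + L * (Φ b - Φ a)) := by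
  rcases hab.eq_or_lt with rfl | hab
  · simp
  have h1 : ContinuousWithinAt (fun b => c * ‖g b - g a‖ ^ 2) (Iio b) b := by
    have : Continuous fun b => c * ‖g b - g a‖ ^ 2 := by fun_prop
    exact this.continuousWithinAt
  have h2 : ContinuousWithinAt (fun b =>
      (b - a) * (‖u' a‖ ^ 2 / 2 - ‖u' b‖ ^ 2 / 2 + L * (Φ b - Φ a))) (Iio b) b := by
    have : Continuous fun b =>
      (b - a) * (‖u' a‖ ^ 2 / 2 - ‖u' b‖ ^ 2 / 2 + L * (Φ b - Φ a)) := by fun_prop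
    exact this.continuousWithinAt
  refine le_of_tendsto_of_tendsto h1 h2 ?_
  have h3 : ∀ᶠ x in 𝓝[<] b, a < x := (eventually_gt_nhds hab).filter_mono nhdsWithin_le_nhds
  filter_upwards [h3, self_mem_nhdsWithin] with x hax (hxb : x < b)
  exact mul_norm_sub_sq_le_energy_of_lt hc hu hu' hg hΦ hL hf hmono ha hax (hxb.trans_le hbT)

/-- Time regularity: `c ‖g(b) - g(a)‖² ≤ (b - a) (Ψ(b) - Ψ(a))`, the integrated form of
`g' ∈ L²((0,T), K)`, where the total increment of `Ψ` is controlled by `u'(0)` and by the total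
variation of `f`. -/
lemma exists_modulus_of_global {T c : ℝ} (hT : 0 ≤ T) (hc : 0 < c) {u u' f : ℝ → H} {g : ℝ → K}
    {Φ : ℝ → ℝ} (hu : ∀ t, HasDerivAt u (u' t) t) (hu' : Continuous u') (hg : Continuous g)
    (hΦ : Continuous Φ)
    (hf : ∀ s ∈ Icc 0 T, ∀ t ∈ Icc 0 T, s ≤ t → ‖f t - f s‖ ≤ Φ t - Φ s)
    (hmono : ∀ s ∈ Icc 0 T, ∀ t ∈ Icc 0 T,
      c * ‖g t - g s‖ ^ 2 + inner ℝ (u' t - u' s) (u t - u s) ≤ inner ℝ (f t - f s) (u t - u s)) :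
    ∃ Ψ : ℝ → ℝ, (∀ a b, 0 ≤ a → a ≤ b → b ≤ T → c * ‖g b - g a‖ ^ 2 ≤ (b - a) * (Ψ b - Ψ a)) ∧
      (∀ a b, 0 ≤ a → a ≤ b → b ≤ T → Ψ a ≤ Ψ b) ∧
      ∀ b ∈ Icc 0 T, Ψ b - Ψ 0 ≤ (‖u' 0‖ + 2 * (Φ T - Φ 0)) ^ 2 := by
  obtain ⟨m, hm, hmax⟩ := isCompact_Icc.exists_isMaxOn (nonempty_Icc.2 hT)
    (f := fun t => ‖u' t‖) (by fun_prop)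
  have h0T : (0 : ℝ) ∈ Icc 0 T := ⟨le_rfl, hT⟩
  have hTT : T ∈ Icc 0 T := ⟨hT, le_rfl⟩
  set L := ‖u' m‖ with hL
  have hLle : ∀ t ∈ Icc 0 T, ‖u' t‖ ≤ L := fun t ht => hmax ht
  have key := fun a b ha hab hb => mul_norm_sub_sq_le_energy (a := a) (b := b) hc hu hu' hg hΦ
    hLle hf hmono ha hab hb
  have hpos : ∀ a b, 0 ≤ a → a ≤ b → b ≤ T →
      0 ≤ ‖u' a‖ ^ 2 / 2 - ‖u' b‖ ^ 2 / 2 + L * (Φ b - Φ a) := by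
    intro a b ha hab hb
    rcases hab.eq_or_lt with rfl | hlt
    · simp
    · have h1 : 0 ≤ c * ‖g b - g a‖ ^ 2 := by positivity
      exact nonneg_of_mul_nonneg_right (h1.trans (key a b ha hab hb)) (sub_pos.2 hlt)
  have hΦmono : ∀ s ∈ Icc 0 T, ∀ t ∈ Icc 0 T, s ≤ t → Φ s ≤ Φ t := fun s hs t ht hst =>
    sub_nonneg.1 ((norm_nonneg _).trans (hf s hs t ht hst))
  have hL0 : 0 ≤ L := norm_nonneg _
  have hY : 0 ≤ Φ T - Φ 0 := sub_nonneg.2 (hΦmono 0 h0T T hTT hT)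
  have hX : 0 ≤ ‖u' 0‖ := norm_nonneg _
  -- The estimate at a maximum point of `‖u'‖` bounds the maximum itself.
  have hLbound : L ≤ ‖u' 0‖ + 2 * (Φ T - Φ 0) := by
    have h1 := hpos 0 m le_rfl hm.1 hm.2
    have h2 := hΦmono m hm T hTT hm.2
    have h3 : L * (Φ m - Φ 0) ≤ L * (Φ T - Φ 0) := by gcongr
    by_contra! hcon
    have h4 : L ^ 2 ≤ ‖u' 0‖ ^ 2 + 2 * (L * (Φ T - Φ 0)) := by linarith
    nlinarith
  refine ⟨fun t => L * Φ t - ‖u' t‖ ^ 2 / 2, fun a b ha hab hb => ?_, fun a b ha hab hb => ?_,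
    fun b hb => ?_⟩
  · refine (key a b ha hab hb).trans (le_of_eq ?_)
    ring
  · have := hpos a b ha hab hb
    simp only
    linarith
  · have h2 := hΦmono b hb T hTT hb.2
    have h3 : L * (Φ b - Φ 0) ≤ (‖u' 0‖ + 2 * (Φ T - Φ 0)) * (Φ T - Φ 0) := by
      have := hΦmono 0 h0T b hb hb.1
      gcongr
    have h4 : 0 ≤ ‖u' b‖ ^ 2 := by positivity
    have h5 : 0 ≤ ‖u' 0‖ * (Φ T - Φ 0) := by positivity
    simp only
    nlinarith

/-- Time regularity for curves given on `[0, T]` only. -/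
lemma exists_modulus [CompleteSpace H] {T c : ℝ} (hT : 0 ≤ T) (hc : 0 < c) {u u' f : ℝ → H}
    {g : ℝ → K} {Φ : ℝ → ℝ} (hu : ∀ t ∈ Icc 0 T, HasDerivWithinAt u (u' t) (Icc 0 T) t)
    (hu' : ContinuousOn u' (Icc 0 T)) (hΦ : ContinuousOn Φ (Icc 0 T))
    (hf : ∀ s ∈ Icc 0 T, ∀ t ∈ Icc 0 T, s ≤ t → ‖f t - f s‖ ≤ Φ t - Φ s)
    (hmono : ∀ s ∈ Icc 0 T, ∀ t ∈ Icc 0 T,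
      c * ‖g t - g s‖ ^ 2 + inner ℝ (u' t - u' s) (u t - u s) ≤ inner ℝ (f t - f s) (u t - u s)) :
    ∃ Ψ : ℝ → ℝ, (∀ a b, 0 ≤ a → a ≤ b → b ≤ T → c * ‖g b - g a‖ ^ 2 ≤ (b - a) * (Ψ b - Ψ a)) ∧
      (∀ a b, 0 ≤ a → a ≤ b → b ≤ T → Ψ a ≤ Ψ b) ∧
      ∀ b ∈ Icc 0 T, Ψ b - Ψ 0 ≤ (‖u' 0‖ + 2 * (Φ T - Φ 0)) ^ 2 := by
  have hucont : ContinuousOn u (Icc 0 T) := fun t ht => (hu t ht).continuousWithinAt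
  have hfcont : ContinuousOn f (Icc 0 T) := by
    intro s hs
    have h1 : ∀ t ∈ Icc 0 T, ‖f t - f s‖ ≤ |Φ t - Φ s| := by
      intro t ht
      rcases le_total s t with h | h
      · exact (hf s hs t ht h).trans (le_abs_self _)
      · rw [norm_sub_rev, abs_sub_comm]
        exact (hf t ht s hs h).trans (le_abs_self _)
    rw [ContinuousWithinAt, tendsto_iff_norm_sub_tendsto_zero]
    have h2 : Tendsto (fun t => |Φ t - Φ s|) (𝓝[Icc 0 T] s) (𝓝 0) := by
      have := ((hΦ s hs).tendsto.sub_const (Φ s)).abs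
      simpa using this
    exact tendsto_of_tendsto_of_tendsto_of_le_of_le' tendsto_const_nhds h2
      (Eventually.of_forall fun _ => norm_nonneg _)
      (eventually_mem_nhdsWithin.mono h1)
  have hgcont : ContinuousOn g (Icc 0 T) := by
    intro s hs
    rw [ContinuousWithinAt, tendsto_iff_norm_sub_tendsto_zero]
    have h2 : Tendsto (fun t => c⁻¹ * (inner ℝ (f t - f s) (u t - u s) -
        inner ℝ (u' t - u' s) (u t - u s))) (𝓝[Icc 0 T] s) (𝓝 0) := by
      have hus := (hucont s hs).tendsto.sub_const (u s)
      have hus' := (hu' s hs).tendsto.sub_const (u' s)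
      have hfs := (hfcont s hs).tendsto.sub_const (f s)
      simpa using ((hfs.inner hus).sub (hus'.inner hus)).const_mul c⁻¹
    have h3 : Tendsto (fun t => ‖g t - g s‖ ^ 2) (𝓝[Icc 0 T] s) (𝓝 0) := by
      refine tendsto_of_tendsto_of_tendsto_of_le_of_le' tendsto_const_nhds h2
        (Eventually.of_forall fun _ => by positivity)
        (eventually_mem_nhdsWithin.mono fun t ht => ?_)
      have := hmono s hs t ht
      rw [inv_mul_eq_div, le_div_iff₀ hc]
      linarith
    have h4 := h3.sqrt
    simpa using h4
  -- Extend all curves to the real line.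
  set π : ℝ → ℝ := fun t => projIcc 0 T hT t with hπ
  have hπc : Continuous π := continuous_subtype_val.comp continuous_projIcc
  have hπmem : ∀ t, π t ∈ Icc 0 T := fun t => (projIcc 0 T hT t).2
  have hπeq : ∀ t ∈ Icc 0 T, π t = t := fun t ht => by
    simp only [hπ, projIcc_of_mem hT ht]
  have hU' : Continuous fun t => u' (π t) := hu'.comp_continuous hπc hπmem
  have hΦ' : Continuous fun t => Φ (π t) := hΦ.comp_continuous hπc hπmem
  have hg' : Continuous fun t => g (π t) := hgcont.comp_continuous hπc hπmem
  have hUeq : ∀ t ∈ Icc 0 T, u 0 + ∫ s in (0 : ℝ)..t, u' (π s) = u t := by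
    intro t ht
    have h1 : ∫ s in (0 : ℝ)..t, u' (π s) = u t - u 0 := by
      refine intervalIntegral.integral_eq_sub_of_hasDeriv_right_of_le ht.1
        (hucont.mono (Icc_subset_Icc_right ht.2)) (fun x hx => ?_) (hU'.intervalIntegrable _ _)
      have hxT : x ∈ Icc 0 T := ⟨hx.1.le, hx.2.le.trans ht.2⟩
      rw [hπeq x hxT]
      exact ((hu x hxT).hasDerivAt (Icc_mem_nhds hx.1 (hx.2.trans_le ht.2))).hasDerivWithinAt
    rw [h1]
    abel
  have h0T : (0 : ℝ) ∈ Icc 0 T := ⟨le_rfl, hT⟩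
  have hTT : T ∈ Icc 0 T := ⟨hT, le_rfl⟩
  obtain ⟨Ψ, h1, h2, h3⟩ := exists_modulus_of_global (T := T) hT hc
    (u := fun t => u 0 + ∫ s in (0 : ℝ)..t, u' (π s)) (u' := fun t => u' (π t)) (f := f)
    (g := fun t => g (π t)) (Φ := fun t => Φ (π t))
    (fun t => (intervalIntegral.integral_hasDerivAt_right (hU'.intervalIntegrable _ _)
      hU'.stronglyMeasurable.stronglyMeasurableAtFilter hU'.continuousAt).const_add _)
    hU' hg' hΦ'
    (fun s hs t ht hst => by
      rw [hπeq s hs, hπeq t ht]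
      exact hf s hs t ht hst)
    (fun s hs t ht => by
      rw [hUeq s hs, hUeq t ht, hπeq s hs, hπeq t ht]
      exact hmono s hs t ht)
  refine ⟨Ψ, fun a b ha hab hb => ?_, h2, fun b hb => ?_⟩
  · have := h1 a b ha hab hb
    rwa [hπeq a ⟨ha, hab.trans hb⟩, hπeq b ⟨ha.trans hab, hb⟩] at this
  · have := h3 b hb
    rwa [hπeq 0 h0T, hπeq T hTT] at this

end Energy

/-! ### The implicit Euler scheme for abstract monotone problems -/

section Euler

variable {V H K : Type*} [AddCommGroup V] [Module ℝ V] [NormedAddCommGroup H]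
  [InnerProductSpace ℝ H] [CompleteSpace H] [NormedAddCommGroup K] [NormedSpace ℝ K]
  [CompleteSpace K]

/-- The error of the implicit Euler scheme for `⟨U', ξ⟩ + a(U, ξ) = ⟨f, ξ⟩`. The form `a` is
monotone and satisfies Young's inequality with respect to the distance `‖N v - N w‖`, and the
initial value is regular in the sense that `a(U(0), ·)` is bounded with respect to `H`. -/
theorem euler_error {T c C Λ : ℝ} (hT : 0 < T) (hc : 0 < c) (hC : 0 ≤ C) (hΛ : 0 ≤ Λ)
    (ι : V →ₗ[ℝ] H)
    (N : V → K) (a : V → V → ℝ)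
    (hmono : ∀ v w, c * ‖N v - N w‖ ^ 2 ≤ a v (v - w) - a w (v - w))
    (hyoung : ∀ v w z, |a v (v - z) - a w (v - z)| ≤
      c / 2 * ‖N v - N z‖ ^ 2 + C * ‖N v - N w‖ ^ 2)
    {f : ℝ → H} {Φ : ℝ → ℝ} (hfc : ContinuousOn f (Icc 0 T)) (hΦ : ContinuousOn Φ (Icc 0 T))
    (hf : ∀ s ∈ Icc 0 T, ∀ t ∈ Icc 0 T, s ≤ t → ‖f t - f s‖ ≤ Φ t - Φ s)
    {U U' : ℝ → V}
    (hU : ∀ t ∈ Icc 0 T, HasDerivWithinAt (fun s => ι (U s)) (ι (U' t)) (Icc 0 T) t)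
    (hU' : ContinuousOn (fun t => ι (U' t)) (Icc 0 T))
    (heq : ∀ t ∈ Icc 0 T, ∀ ξ, inner ℝ (ι (U' t)) (ι ξ) + a (U t) ξ = inner ℝ (f t) (ι ξ))
    (hinit : ∀ ξ, |a (U 0) ξ| ≤ Λ * ‖ι ξ‖)
    {M : ℕ} {τ : ℝ} (hτ : 0 < τ) (hMτ : M * τ = T) {W : ℕ → V} (hW0 : W 0 = U 0)
    (hW : ∀ n ∈ Finset.Icc 1 M, ∀ ξ, inner ℝ (ι (τ⁻¹ • (W n - W (n - 1)))) (ι ξ) + a (W n) ξ =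
      inner ℝ (τ⁻¹ • ∫ s in (((n : ℝ) - 1) * τ)..((n : ℝ) * τ), f s) (ι ξ)) :
    ∀ n ≤ M, ‖ι (U (n * τ) - W n)‖ ^ 2 +
        c * (τ * ∑ j ∈ Finset.Icc 1 n, ‖N (U (j * τ)) - N (W j)‖ ^ 2) ≤
      2 * C / c * (‖f 0‖ + Λ + 2 * (Φ T - Φ 0)) ^ 2 * τ ^ 2 := by
  have h0T : (0 : ℝ) ∈ Icc 0 T := ⟨le_rfl, hT.le⟩
  have hTT : T ∈ Icc 0 T := ⟨hT.le, le_rfl⟩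
  obtain ⟨Ψ, hΨ, hΨmono, hΨle⟩ := exists_modulus (g := fun t => N (U t)) hT.le hc hU hU' hΦ hf (by
    intro s hs t ht
    have h1 := heq s hs (U t - U s)
    have h2 := heq t ht (U t - U s)
    have h3 := hmono (U t) (U s)
    rw [inner_sub_left, inner_sub_left, ← map_sub]
    linarith)
  have hΦ0 : 0 ≤ Φ T - Φ 0 := (norm_nonneg _).trans (hf 0 h0T T hTT hT.le)
  have hU'0 : ‖ι (U' 0)‖ ≤ ‖f 0‖ + Λ := by
    have h1 := heq 0 h0T (U' 0)
    have h2 := (abs_le.1 (hinit (U' 0))).1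
    have h3 := real_inner_le_norm (f 0) (ι (U' 0))
    rw [real_inner_self_eq_norm_sq] at h1
    rcases eq_or_lt_of_le (norm_nonneg (ι (U' 0))) with h | h
    · rw [← h]
      positivity
    · refine le_of_mul_le_mul_right ?_ h
      nlinarith
  have htn : ∀ n : ℕ, n ≤ M → (n : ℝ) * τ ∈ Icc 0 T := by
    intro n hn
    refine ⟨by positivity, ?_⟩
    rw [← hMτ]
    gcongr
  have hstep : ∀ n : ℕ, n + 1 ≤ M →
      ‖ι (U ((n + 1 : ℕ) * τ) - W (n + 1))‖ ^ 2 +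
        c * (τ * ‖N (U ((n + 1 : ℕ) * τ)) - N (W (n + 1))‖ ^ 2) ≤
      ‖ι (U (n * τ) - W n)‖ ^ 2 + 2 * C / c * τ ^ 2 * (Ψ ((n + 1 : ℕ) * τ) - Ψ (n * τ)) := by
    intro n hn
    have htb := htn (n + 1) hn
    have hta := htn n (by omega)
    set tb : ℝ := (n + 1 : ℕ) * τ with htbd
    set ta : ℝ := n * τ with htad
    have htab : tb - ta = τ := by
      rw [htbd, htad]
      push_cast
      ring
    have hle : ta ≤ tb := by linarith
    have hsub : Icc ta tb ⊆ Icc 0 T := Icc_subset_Icc hta.1 htb.2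
    set ξ := U tb - W (n + 1) with hξ
    set x := ι ξ with hx
    have hcont : ContinuousOn (fun s => inner ℝ (ι (U' s) - f s) x) (Icc ta tb) :=
      (((hU'.sub hfc).mono hsub).inner continuousOn_const)
    have hU'i : IntervalIntegrable (fun s => ι (U' s)) volume ta tb :=
      (hU'.mono hsub).intervalIntegrable_of_Icc hle
    have hfi : IntervalIntegrable f volume ta tb :=
      (hfc.mono hsub).intervalIntegrable_of_Icc hle
    set B := c / 2 * ‖N (U tb) - N (W (n + 1))‖ ^ 2 + C * (c⁻¹ * (τ * (Ψ tb - Ψ ta))) with hB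
    -- By the equation at time `s`, the integrand is `-a(U(s), ξ)`; Young's inequality replaces it by
    -- the value at the end of the step, up to the time increment of `N ∘ U`.
    have hpt : ∀ s ∈ Icc ta tb, inner ℝ (ι (U' s) - f s) x ≤ B - a (U tb) ξ := by
      intro s hs
      have h1 := heq s (hsub hs) ξ
      have h2 := (abs_le.1 (hyoung (U tb) (U s) (W (n + 1)))).2
      have h3 := hΨ s tb (hsub hs).1 hs.2 htb.2
      have h4 : (tb - s) * (Ψ tb - Ψ s) ≤ τ * (Ψ tb - Ψ ta) := by
        have h5 := hΨmono s tb (hsub hs).1 hs.2 htb.2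
        have h6 := hΨmono ta s hta.1 hs.1 (hsub hs).2
        have h7 := hs.1
        gcongr
        linarith
      have h5 : ‖N (U tb) - N (U s)‖ ^ 2 ≤ c⁻¹ * (τ * (Ψ tb - Ψ ta)) := by
        rw [inv_mul_eq_div, le_div_iff₀ hc]
        linarith
      have h6 := mul_le_mul_of_nonneg_left h5 hC
      rw [inner_sub_left]
      linarith
    have hI := intervalIntegral.integral_mono_on (μ := volume) hle (hcont.intervalIntegrable_of_Icc hle)
      intervalIntegrable_const hpt
    rw [intervalIntegral.integral_const, htab, smul_eq_mul] at hI
    have hFTC : ∫ s in ta..tb, ι (U' s) = ι (U tb) - ι (U ta) := by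
      refine intervalIntegral.integral_eq_sub_of_hasDeriv_right_of_le hle
        (fun s hs => ((hU s (hsub hs)).continuousWithinAt).mono hsub) (fun s hs => ?_) hU'i
      refine ((hU s (hsub (Ioo_subset_Icc_self hs))).hasDerivAt (Icc_mem_nhds ?_ ?_)).hasDerivWithinAt
      · exact hta.1.trans_lt hs.1
      · exact hs.2.trans_le htb.2
    have hI2 : ∫ s in ta..tb, inner ℝ (ι (U' s) - f s) x =
        inner ℝ (ι (U tb) - ι (U ta)) x - inner ℝ (∫ s in ta..tb, f s) x := by
      have h1 := (innerSL ℝ x).intervalIntegral_comp_comm (hU'i.sub hfi)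
      simp only [innerSL_apply_apply] at h1
      simp_rw [real_inner_comm x]
      rw [h1, intervalIntegral.integral_sub hU'i hfi, hFTC, inner_sub_right]
    have hE := hW (n + 1) (Finset.mem_Icc.2 ⟨by omega, hn⟩) ξ
    have hta' : (((n + 1 : ℕ) : ℝ) - 1) * τ = ta := by
      rw [htad]
      push_cast
      ring
    rw [Nat.add_sub_cancel, hta', ← htbd, map_smul, inner_smul_left, inner_smul_left,
      conj_trivial, ← hx, map_sub] at hE
    have hE2 : inner ℝ (ι (W (n + 1)) - ι (W n)) x + τ * a (W (n + 1)) ξ =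
        inner ℝ (∫ s in ta..tb, f s) x := by
      have h1 := congrArg (fun y => τ * y) hE
      simp only [mul_add, ← mul_assoc, mul_inv_cancel₀ hτ.ne', one_mul] at h1
      exact h1
    have hm := hmono (U tb) (W (n + 1))
    have hm2 := mul_le_mul_of_nonneg_left hm hτ.le
    rw [hI2] at hI
    have hxe : x = ι (U tb) - ι (W (n + 1)) := by rw [hx, hξ, map_sub]
    have hdiff : inner ℝ (x - ι (U ta - W n)) x =
        inner ℝ (ι (U tb) - ι (U ta)) x - inner ℝ (ι (W (n + 1)) - ι (W n)) x := by
      rw [← inner_sub_left]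
      congr 1
      rw [hxe, map_sub]
      abel
    have hpol : ‖x‖ ^ 2 ≤ ‖ι (U ta - W n)‖ ^ 2 + 2 * inner ℝ (x - ι (U ta - W n)) x := by
      have h1 := real_inner_le_norm (ι (U ta - W n)) x
      rw [inner_sub_left, real_inner_self_eq_norm_sq]
      nlinarith [sq_nonneg (‖x‖ - ‖ι (U ta - W n)‖)]
    have hBe : τ * B = c / 2 * (τ * ‖N (U tb) - N (W (n + 1))‖ ^ 2) +
        C / c * τ ^ 2 * (Ψ tb - Ψ ta) := by
      rw [hB]
      field_simp
    have e3 : 2 * C / c * τ ^ 2 * (Ψ tb - Ψ ta) = 2 * (C / c * τ ^ 2 * (Ψ tb - Ψ ta)) := by ring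
    rw [e3]
    have e4 : τ * (B - a (U tb) ξ) = τ * B - τ * a (U tb) ξ := by ring
    rw [e4, hBe] at hI
    have e5 : τ * (c * ‖N (U tb) - N (W (n + 1))‖ ^ 2) =
      c * (τ * ‖N (U tb) - N (W (n + 1))‖ ^ 2) := by ring
    rw [e5, mul_sub, ← hξ] at hm2
    linarith
  have hsum : ∀ n ≤ M, ‖ι (U (n * τ) - W n)‖ ^ 2 +
      c * (τ * ∑ j ∈ Finset.Icc 1 n, ‖N (U (j * τ)) - N (W j)‖ ^ 2) ≤
      2 * C / c * τ ^ 2 * (Ψ (n * τ) - Ψ 0) := by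
    intro n
    induction n with
    | zero => simp [hW0]
    | succ n ih =>
      intro hn
      have h1 := ih (by omega)
      have h2 := hstep n hn
      rw [Finset.sum_Icc_succ_top (by omega), mul_add, mul_add]
      have e : 2 * C / c * τ ^ 2 * (Ψ ((n + 1 : ℕ) * τ) - Ψ 0) =
        2 * C / c * τ ^ 2 * (Ψ ((n + 1 : ℕ) * τ) - Ψ (n * τ)) +
        2 * C / c * τ ^ 2 * (Ψ (n * τ) - Ψ 0) := by ring
      rw [e]
      linarith
  intro n hn
  refine (hsum n hn).trans ?_
  have h1 := hΨle (n * τ) (htn n hn)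
  have h2 : (‖ι (U' 0)‖ + 2 * (Φ T - Φ 0)) ^ 2 ≤ (‖f 0‖ + Λ + 2 * (Φ T - Φ 0)) ^ 2 := by
    gcongr
  calc _ ≤ 2 * C / c * τ ^ 2 * (‖f 0‖ + Λ + 2 * (Φ T - Φ 0)) ^ 2 := by
        gcongr
        exact h1.trans h2
    _ = _ := by ring

end Euler

/-! ### Calculus of weak gradients -/

section WeakGrad

variable {d : ℕ} {κ : Type*} [Fintype κ] {Ω : Set (Vec d)}

lemma locallyIntegrableOn_coord {u : Vec d → EuclideanSpace ℝ κ}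
    (hu : LocallyIntegrableOn u Ω) (i : κ) : LocallyIntegrableOn (fun x => u x i) Ω := by
  intro x hx
  obtain ⟨s, hs, hint⟩ := hu x hx
  exact ⟨s, hs, (EuclideanSpace.proj (𝕜 := ℝ) i).integrable_comp hint⟩

lemma integrable_mul_of_tsupport_subset {f η : Vec d → ℝ} (hf : LocallyIntegrableOn f Ω)
    (hη : Continuous η) (hc : HasCompactSupport η) (hs : tsupport η ⊆ Ω) :
    Integrable (fun x => f x * η x) (volume.restrict Ω) := by
  have h1 : IntegrableOn (fun x => f x * η x) (tsupport η) :=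
    (hf.integrableOn_compact_subset hs hc).mul_continuousOn hη.continuousOn hc
  refine (integrableOn_iff_integrable_of_support_subset fun x hx => ?_).1 h1 |>.integrableOn
  by_contra h
  rw [Function.mem_support, image_eq_zero_of_notMem_tsupport h, mul_zero] at hx
  exact hx rfl

/-- Weak gradients are unique up to null sets. -/
lemma HasWeakGrad.ae_eq (hΩ : IsOpen Ω) {u : Vec d → EuclideanSpace ℝ κ}
    {G G' : Vec d → EuclideanSpace ℝ (κ × Fin d)} (h : HasWeakGrad Ω u G)
    (h' : HasWeakGrad Ω u G') : G =ᵐ[volume.restrict Ω] G' := by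
  have hcoord : ∀ ij : κ × Fin d, ∀ᵐ x ∂(volume.restrict Ω), G x ij = G' x ij := by
    intro ij
    have hG := locallyIntegrableOn_coord h.2.1 ij
    have hG' := locallyIntegrableOn_coord h'.2.1 ij
    have h0 : ∀ᵐ x ∂(volume : Measure (Vec d)), x ∈ Ω → G x ij - G' x ij = 0 := by
      refine hΩ.ae_eq_zero_of_integral_contDiff_smul_eq_zero (hG.sub hG') fun η hη hc hs => ?_
      have e : ∫ x, η x • (G x ij - G' x ij) = ∫ x in Ω, η x • (G x ij - G' x ij) := by
        refine (setIntegral_eq_integral_of_forall_compl_eq_zero fun x hx => ?_).symm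
        rw [image_eq_zero_of_notMem_tsupport fun h => hx (hs h), zero_smul]
      rw [e]
      simp only [smul_eq_mul, mul_comm (η _), sub_mul]
      rw [integral_sub (integrable_mul_of_tsupport_subset hG hη.continuous hc hs)
        (integrable_mul_of_tsupport_subset hG' hη.continuous hc hs)]
      have h1 := h.2.2 η hη hc hs ij.1 ij.2
      have h2 := h'.2.2 η hη hc hs ij.1 ij.2
      rw [Prod.mk.eta] at h1 h2
      linarith
    filter_upwards [ae_restrict_of_ae h0, ae_restrict_mem hΩ.measurableSet] with x hx hxΩ
    exact sub_eq_zero.1 (hx hxΩ)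
  filter_upwards [ae_all_iff.2 hcoord] with x hx
  ext ij
  exact hx ij

lemma WeaklyDifferentiable.hasWeakGrad {u : Vec d → EuclideanSpace ℝ κ}
    (h : WeaklyDifferentiable Ω u) : HasWeakGrad Ω u (weakGrad Ω u) := by
  rw [weakGrad, dif_pos h]
  exact h.choose_spec

lemma HasWeakGrad.weakGrad_ae_eq (hΩ : IsOpen Ω) {u : Vec d → EuclideanSpace ℝ κ}
    {G : Vec d → EuclideanSpace ℝ (κ × Fin d)} (h : HasWeakGrad Ω u G) :
    weakGrad Ω u =ᵐ[volume.restrict Ω] G :=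
  HasWeakGrad.ae_eq hΩ (WeaklyDifferentiable.hasWeakGrad ⟨G, h⟩) h

lemma integrable_mul_fderiv {f η : Vec d → ℝ} (hf : LocallyIntegrableOn f Ω)
    (hη : ContDiff ℝ ∞ η) (hc : HasCompactSupport η) (hs : tsupport η ⊆ Ω) (v : Vec d) :
    Integrable (fun x => f x * fderiv ℝ η x v) (volume.restrict Ω) :=
  integrable_mul_of_tsupport_subset hf
    ((hη.continuous_fderiv (by simp)).clm_apply continuous_const) (hc.fderiv_apply ℝ v)
    ((tsupport_fderiv_apply_subset ℝ v).trans hs)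

lemma HasWeakGrad.add {u v : Vec d → EuclideanSpace ℝ κ}
    {G G' : Vec d → EuclideanSpace ℝ (κ × Fin d)} (hu : HasWeakGrad Ω u G)
    (hv : HasWeakGrad Ω v G') : HasWeakGrad Ω (u + v) (G + G') := by
  refine ⟨hu.1.add hv.1, hu.2.1.add hv.2.1, fun η hη hc hs i j => ?_⟩
  simp only [Pi.add_apply, PiLp.add_apply, add_mul]
  rw [integral_add (integrable_mul_fderiv (locallyIntegrableOn_coord hu.1 i) hη hc hs _)
      (integrable_mul_fderiv (locallyIntegrableOn_coord hv.1 i) hη hc hs _),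
    integral_add
      (integrable_mul_of_tsupport_subset (locallyIntegrableOn_coord hu.2.1 _) hη.continuous hc hs)
      (integrable_mul_of_tsupport_subset (locallyIntegrableOn_coord hv.2.1 _) hη.continuous hc hs),
    hu.2.2 η hη hc hs, hv.2.2 η hη hc hs]
  ring

lemma HasWeakGrad.const_smul {u : Vec d → EuclideanSpace ℝ κ}
    {G : Vec d → EuclideanSpace ℝ (κ × Fin d)} (hu : HasWeakGrad Ω u G) (c : ℝ) :
    HasWeakGrad Ω (c • u) (c • G) := by
  refine ⟨hu.1.smul c, hu.2.1.smul c, fun η hη hc hs i j => ?_⟩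
  simp only [Pi.smul_apply, PiLp.smul_apply, smul_eq_mul, mul_assoc]
  rw [integral_const_mul, integral_const_mul, hu.2.2 η hη hc hs]
  ring

lemma HasWeakGrad.zero : HasWeakGrad Ω (0 : Vec d → EuclideanSpace ℝ κ) 0 := by
  refine ⟨locallyIntegrableOn_zero, locallyIntegrableOn_zero, fun η hη hc hs i j => ?_⟩
  simp

/-- The matrix of first derivatives `∂_j u_i`. -/
def classicalGrad (u : Vec d → EuclideanSpace ℝ κ) (x : Vec d) : EuclideanSpace ℝ (κ × Fin d) :=
  WithLp.toLp 2 fun ij => fderiv ℝ u x (EuclideanSpace.single ij.2 1) ij.1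

lemma continuous_classicalGrad {u : Vec d → EuclideanSpace ℝ κ} (hu : ContDiff ℝ ∞ u) :
    Continuous (classicalGrad u) := by
  have h := hu.continuous_fderiv (by simp)
  refine (PiLp.continuous_toLp 2 _).comp (continuous_pi fun ij => ?_)
  exact (EuclideanSpace.proj (𝕜 := ℝ) ij.1).continuous.comp (h.clm_apply continuous_const)

lemma fderiv_coord_eq_classicalGrad {u : Vec d → EuclideanSpace ℝ κ} (hu : ContDiff ℝ ∞ u)
    (x : Vec d) (i : κ) (j : Fin d) :
    fderiv ℝ (fun x => u x i) x (EuclideanSpace.single j 1) = classicalGrad u x (i, j) := by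
  have h1 : HasFDerivAt (fun x => u x i)
      ((EuclideanSpace.proj (𝕜 := ℝ) i).comp (fderiv ℝ u x)) x :=
    (EuclideanSpace.proj (𝕜 := ℝ) i).hasFDerivAt.comp x
      (hu.differentiable (by simp) x).hasFDerivAt
  rw [h1.fderiv]
  rfl

lemma hasWeakGrad_classicalGrad {u : Vec d → EuclideanSpace ℝ κ} (hu : ContDiff ℝ ∞ u) :
    HasWeakGrad Ω u (classicalGrad u) := by
  refine ⟨hu.continuous.locallyIntegrable.locallyIntegrableOn _,
    (continuous_classicalGrad hu).locallyIntegrable.locallyIntegrableOn _,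
    fun η hη hc hs i j => ?_⟩
  have hui : ContDiff ℝ ∞ fun x => u x i := (EuclideanSpace.proj (𝕜 := ℝ) i).contDiff.comp hu
  have hcg : Continuous fun x => classicalGrad u x (i, j) :=
    (EuclideanSpace.proj (𝕜 := ℝ) (i, j)).continuous.comp (continuous_classicalGrad hu)
  have hfdη : Continuous fun x => fderiv ℝ η x (EuclideanSpace.single j 1) :=
    (hη.continuous_fderiv (by simp)).clm_apply continuous_const
  rw [setIntegral_eq_integral_of_forall_compl_eq_zero,
    setIntegral_eq_integral_of_forall_compl_eq_zero]
  · rw [integral_mul_fderiv_eq_neg_fderiv_mul_of_integrable]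
    · simp_rw [fderiv_coord_eq_classicalGrad hu]
    · simp_rw [fderiv_coord_eq_classicalGrad hu]
      exact (hcg.mul hη.continuous).integrable_of_hasCompactSupport hc.mul_left
    · exact (hui.continuous.mul hfdη).integrable_of_hasCompactSupport
        (hc.fderiv_apply ℝ _).mul_left
    · exact (hui.continuous.mul hη.continuous).integrable_of_hasCompactSupport hc.mul_left
    · exact fun x _ => hui.differentiable (by simp) x
    · exact fun x _ => hη.differentiable (by simp) x
  · intro x hx
    rw [image_eq_zero_of_notMem_tsupport fun h => hx (hs h), mul_zero]
  · intro x hx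
    have h1 : x ∉ tsupport fun x => fderiv ℝ η x (EuclideanSpace.single j 1) := fun h =>
      hx (hs (tsupport_fderiv_apply_subset ℝ _ h))
    rw [image_eq_zero_of_notMem_tsupport h1, mul_zero]

end WeakGrad

/-! ### The spaces `W^{1,p}` and `W_0^{1,p}` -/

section Sobolev

variable {d : ℕ} {Ω : Set (Vec d)} {p : ℝ}

lemma weakGrad_add_ae (hΩ : IsOpen Ω) {u v : Vec d → Vec d} (hu : WeaklyDifferentiable Ω u)
    (hv : WeaklyDifferentiable Ω v) :
    weakGrad Ω (u + v) =ᵐ[volume.restrict Ω] weakGrad Ω u + weakGrad Ω v :=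
  (hu.hasWeakGrad.add hv.hasWeakGrad).weakGrad_ae_eq hΩ

lemma weakGrad_smul_ae (hΩ : IsOpen Ω) (c : ℝ) {u : Vec d → Vec d}
    (hu : WeaklyDifferentiable Ω u) :
    weakGrad Ω (c • u) =ᵐ[volume.restrict Ω] c • weakGrad Ω u :=
  (hu.hasWeakGrad.const_smul c).weakGrad_ae_eq hΩ

lemma HasWeakGrad.memW1p (hΩ : IsOpen Ω) {u : Vec d → Vec d} {G : Vec d → Tensor d}
    (h : HasWeakGrad Ω u G) (hu : MemLp u (ENNReal.ofReal p) (volume.restrict Ω))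
    (hG : MemLp G (ENNReal.ofReal p) (volume.restrict Ω)) : MemW1p Ω p u :=
  ⟨⟨G, h⟩, hu, (memLp_congr_ae (h.weakGrad_ae_eq hΩ)).2 hG⟩

lemma MemW1p.add (hΩ : IsOpen Ω) {u v : Vec d → Vec d} (hu : MemW1p Ω p u)
    (hv : MemW1p Ω p v) : MemW1p Ω p (u + v) :=
  (hu.1.hasWeakGrad.add hv.1.hasWeakGrad).memW1p hΩ (hu.2.1.add hv.2.1) (hu.2.2.add hv.2.2)

lemma MemW1p.const_smul (hΩ : IsOpen Ω) (c : ℝ) {u : Vec d → Vec d} (hu : MemW1p Ω p u) :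
    MemW1p Ω p (c • u) :=
  (hu.1.hasWeakGrad.const_smul c).memW1p hΩ (hu.2.1.const_smul c) (hu.2.2.const_smul c)

lemma MemW1p.sub (hΩ : IsOpen Ω) {u v : Vec d → Vec d} (hu : MemW1p Ω p u)
    (hv : MemW1p Ω p v) : MemW1p Ω p (u - v) := by
  rw [sub_eq_add_neg, ← neg_one_smul ℝ v]
  exact hu.add hΩ (hv.const_smul hΩ _)

lemma w1pNorm_add_le (hΩ : IsOpen Ω) (hp : 1 ≤ p) {u v : Vec d → Vec d} (hu : MemW1p Ω p u)
    (hv : MemW1p Ω p v) : w1pNorm Ω p (u + v) ≤ w1pNorm Ω p u + w1pNorm Ω p v := by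
  have hp' : 1 ≤ ENNReal.ofReal p := ENNReal.one_le_ofReal.2 hp
  unfold w1pNorm lqNorm
  rw [eLpNorm_congr_ae (weakGrad_add_ae hΩ hu.1 hv.1), add_add_add_comm]
  exact add_le_add (eLpNorm_add_le hu.2.1.1 hv.2.1.1 hp') (eLpNorm_add_le hu.2.2.1 hv.2.2.1 hp')

lemma w1pNorm_const_smul (hΩ : IsOpen Ω) (c : ℝ) {u : Vec d → Vec d}
    (hu : WeaklyDifferentiable Ω u) : w1pNorm Ω p (c • u) = ‖c‖ₑ * w1pNorm Ω p u := by
  unfold w1pNorm lqNorm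
  rw [eLpNorm_congr_ae (weakGrad_smul_ae hΩ c hu), eLpNorm_const_smul, eLpNorm_const_smul,
    mul_add]

lemma w1pNorm_lt_top {u : Vec d → Vec d} (hu : MemW1p Ω p u) : w1pNorm Ω p u < ⊤ :=
  ENNReal.add_lt_top.2 ⟨hu.2.1.2, hu.2.2.2⟩

/-- Smooth compactly supported fields are in `W^{1,p}`. -/
lemma memW1p_of_contDiff (hΩ : IsOpen Ω) {η : Vec d → Vec d} (hη : ContDiff ℝ ∞ η)
    (hc : HasCompactSupport η) : MemW1p Ω p η := by
  refine (hasWeakGrad_classicalGrad hη).memW1p hΩ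
    ((hη.continuous.memLp_of_hasCompactSupport hc).restrict _)
    (((continuous_classicalGrad hη).memLp_of_hasCompactSupport ?_).restrict _)
  refine hc.fderiv ℝ |>.comp_left (g := fun L : Vec d →L[ℝ] Vec d =>
    (WithLp.toLp 2 fun ij : Fin d × Fin d => L (EuclideanSpace.single ij.2 1) ij.1 : Tensor d)) ?_
  ext ij
  simp

lemma memW1pZero_of_contDiff (hΩ : IsOpen Ω) {η : Vec d → Vec d}
    (hη : ContDiff ℝ ∞ η) (hc : HasCompactSupport η) (hs : tsupport η ⊆ Ω) :
    MemW1pZero Ω p η := by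
  refine ⟨memW1p_of_contDiff hΩ hη hc, fun ε hε => ⟨η, hη, hc, hs, ?_⟩⟩
  have h0 : w1pNorm Ω p (0 : Vec d → Vec d) = 0 := by
    unfold w1pNorm lqNorm
    rw [eLpNorm_congr_ae (HasWeakGrad.zero.weakGrad_ae_eq hΩ)]
    simp
  rwa [sub_self, h0]

lemma MemW1pZero.add (hΩ : IsOpen Ω) (hp : 1 ≤ p) {u v : Vec d → Vec d}
    (hu : MemW1pZero Ω p u) (hv : MemW1pZero Ω p v) : MemW1pZero Ω p (u + v) := by
  refine ⟨hu.1.add hΩ hv.1, fun ε hε => ?_⟩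
  obtain ⟨η, hη, hc, hs, h⟩ := hu.2 (ε / 2) (ENNReal.half_pos hε.ne')
  obtain ⟨θ, hθ, hcθ, hsθ, h'⟩ := hv.2 (ε / 2) (ENNReal.half_pos hε.ne')
  refine ⟨η + θ, hη.add hθ, hc.add hcθ, (tsupport_add η θ).trans (union_subset hs hsθ), ?_⟩
  rw [add_sub_add_comm]
  refine (w1pNorm_add_le hΩ hp (hu.1.sub hΩ (memW1p_of_contDiff hΩ hη hc))
    (hv.1.sub hΩ (memW1p_of_contDiff hΩ hθ hcθ))).trans_lt ?_
  rw [← ENNReal.add_halves ε]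
  exact ENNReal.add_lt_add h h'

lemma MemW1pZero.const_smul (hΩ : IsOpen Ω) (c : ℝ) {u : Vec d → Vec d}
    (hu : MemW1pZero Ω p u) : MemW1pZero Ω p (c • u) := by
  refine ⟨hu.1.const_smul hΩ c, fun ε hε => ?_⟩
  have hc : (‖c‖ₑ + 1) ≠ 0 := by simp
  have hc' : (‖c‖ₑ + 1) ≠ ⊤ := by simp
  obtain ⟨η, hη, hcη, hs, h⟩ := hu.2 (ε / (‖c‖ₑ + 1)) (ENNReal.div_pos hε.ne' hc')
  refine ⟨c • η, contDiff_const.smul hη, hcη.comp_left (g := fun y => c • y) (smul_zero c),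
    (closure_mono (Function.support_const_smul_subset c η)).trans hs, ?_⟩
  rw [← smul_sub, w1pNorm_const_smul hΩ c (hu.1.sub hΩ (memW1p_of_contDiff hΩ hη hcη)).1]
  have h1 := (ENNReal.lt_div_iff_mul_lt (.inl hc) (.inl hc')).1 h
  refine lt_of_le_of_lt ?_ h1
  rw [mul_comm]
  gcongr
  exact le_self_add

lemma MemW1pZero.sub (hΩ : IsOpen Ω) (hp : 1 ≤ p) {u v : Vec d → Vec d}
    (hu : MemW1pZero Ω p u) (hv : MemW1pZero Ω p v) : MemW1pZero Ω p (u - v) := by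
  rw [sub_eq_add_neg, ← neg_one_smul ℝ v]
  exact hu.add hΩ hp (hv.const_smul hΩ _)

end Sobolev

/-! ### The embedding of `W_0^{1,p}` into `L²` -/

section Embedding

variable {d : ℕ} {Ω : Set (Vec d)} {p : ℝ}

lemma norm_fderiv_le_classicalGrad (u : Vec d → Vec d) (x : Vec d) :
    ‖fderiv ℝ u x‖ ≤ d * ‖classicalGrad u x‖ := by
  refine ContinuousLinearMap.opNorm_le_bound _ (by positivity) fun y => ?_
  have hcol : ∀ j, ‖fderiv ℝ u x (EuclideanSpace.single j 1)‖ ≤ ‖classicalGrad u x‖ := by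
    intro j
    rw [EuclideanSpace.norm_eq, EuclideanSpace.norm_eq]
    refine Real.sqrt_le_sqrt ?_
    rw [Fintype.sum_prod_type]
    refine Finset.sum_le_sum fun i _ => ?_
    exact Finset.single_le_sum (f := fun j => ‖classicalGrad u x (i, j)‖ ^ 2)
      (fun _ _ => sq_nonneg _) (Finset.mem_univ j)
  have hy : y = ∑ j, y j • EuclideanSpace.single j (1 : ℝ) := by
    have h := (EuclideanSpace.basisFun (Fin d) ℝ).sum_repr y
    simpa using h.symm
  calc ‖fderiv ℝ u x y‖ = ‖∑ j, y j • fderiv ℝ u x (EuclideanSpace.single j 1)‖ := by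
        conv_lhs => rw [hy, map_sum]
        simp only [map_smul]
    _ ≤ ∑ j : Fin d, ‖y‖ * ‖classicalGrad u x‖ := by
        refine (norm_sum_le _ _).trans (Finset.sum_le_sum fun j _ => ?_)
        rw [norm_smul]
        exact mul_le_mul (PiLp.norm_apply_le y j) (hcol j) (norm_nonneg _) (norm_nonneg _)
    _ = _ := by
        rw [Finset.sum_const, Finset.card_univ, Fintype.card_fin, nsmul_eq_mul]
        ring

/-- Gagliardo-Nirenberg-Sobolev inequality for test fields in the case `p < 2`. -/
lemma exists_lqNorm_le_w1pNorm_of_contDiff (hd : 2 ≤ d) (hΩ : IsOpen Ω)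
    (hΩb : Bornology.IsBounded Ω) (hp1 : 1 < p) (hp : 2 * (d : ℝ) / (d + 2) ≤ p) (hp2 : p < 2) :
    ∃ C : ℝ≥0, ∀ η : Vec d → Vec d, ContDiff ℝ ∞ η → tsupport η ⊆ Ω →
      lqNorm Ω 2 η ≤ C * w1pNorm Ω p η := by
  have hp0 : 0 ≤ p := by linarith
  have hd0 : (0 : ℝ) < d := by positivity
  have hd2 : (2 : ℝ) ≤ d := by exact_mod_cast hd
  lift p to ℝ≥0 using hp0
  refine ⟨eLpNormLESNormFDerivOfLeConst (Vec d) (volume : Measure (Vec d)) Ω p 2 * d,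
    fun η hη hs => ?_⟩
  have h1 := eLpNorm_le_eLpNorm_fderiv_of_le (F := Vec d) (volume : Measure (Vec d))
    (u := η) (s := Ω) (p := p) (q := 2) (hη.of_le (by simp)) ((subset_tsupport η).trans hs)
    (by exact_mod_cast hp1.le)
    (by
      rw [finrank_euclideanSpace, Fintype.card_fin]
      exact_mod_cast hp2.trans_le hd2)
    (by
      rw [finrank_euclideanSpace, Fintype.card_fin]
      have h2 : (p : ℝ)⁻¹ ≤ (2 * (d : ℝ) / (d + 2))⁻¹ := by
        gcongr
      have h3 : (2 * (d : ℝ) / (d + 2))⁻¹ = (d : ℝ)⁻¹ + 2⁻¹ := by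
        field_simp
        ring
      push_cast
      linarith) hΩb
  have h2 : eLpNorm (fderiv ℝ η) p volume ≤ d * eLpNorm (weakGrad Ω η) p (volume.restrict Ω) := by
    have hsupp : Function.support (fderiv ℝ η) ⊆ Ω :=
      ((subset_tsupport _).trans (tsupport_fderiv_subset ℝ)).trans hs
    rw [← eLpNorm_restrict_eq_of_support_subset (f := fderiv ℝ η) hsupp,
      eLpNorm_congr_ae ((hasWeakGrad_classicalGrad hη).weakGrad_ae_eq hΩ)]
    have h3 := eLpNorm_le_nnreal_smul_eLpNorm_of_ae_le_mul (μ := volume.restrict Ω)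
      (f := fderiv ℝ η) (g := classicalGrad η) (c := (d : ℝ≥0))
      (Eventually.of_forall fun x => by
        have := norm_fderiv_le_classicalGrad η x
        exact_mod_cast this) p
    rw [ENNReal.smul_def, smul_eq_mul] at h3
    exact_mod_cast h3
  calc lqNorm Ω 2 η = eLpNorm η ((2 : ℝ≥0) : ℝ≥0∞) (volume.restrict Ω) := by
        simp [lqNorm]
    _ ≤ eLpNorm η ((2 : ℝ≥0) : ℝ≥0∞) volume := eLpNorm_restrict_le _ _ _ _
    _ ≤ _ := h1
    _ ≤ eLpNormLESNormFDerivOfLeConst (Vec d) (volume : Measure (Vec d)) Ω p 2 *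
        (d * eLpNorm (weakGrad Ω η) p (volume.restrict Ω)) := by gcongr
    _ ≤ _ := by
        rw [ENNReal.coe_mul, mul_assoc]
        unfold w1pNorm lqNorm
        rw [ENNReal.ofReal_coe_nnreal, ENNReal.coe_natCast]
        gcongr
        exact le_add_self

/-- The embedding `W_0^{1,p}(Ω) ⊂ L²(Ω)` for `p ≥ 2d/(d+2)`. -/
lemma exists_lqNorm_le_w1pNorm (hd : 2 ≤ d) (hΩ : IsOpen Ω) (hΩb : Bornology.IsBounded Ω)
    (hp1 : 1 < p) (hp : 2 * (d : ℝ) / (d + 2) ≤ p) :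
    ∃ C : ℝ≥0, ∀ v : Vec d → Vec d, MemW1pZero Ω p v → lqNorm Ω 2 v ≤ C * w1pNorm Ω p v := by
  rcases lt_or_ge p 2 with hp2 | hp2
  · obtain ⟨C, hC⟩ := exists_lqNorm_le_w1pNorm_of_contDiff hd hΩ hΩb hp1 hp hp2
    refine ⟨C, fun v hv => ?_⟩
    have hε : ∀ n : ℕ, (0 : ℝ≥0∞) < (n + 1 : ℝ≥0∞)⁻¹ := fun n => by simp
    choose η hη hc hs hlt using fun n : ℕ => hv.2 (n + 1 : ℝ≥0∞)⁻¹ (hε n)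
    have hlim : Tendsto (fun n : ℕ => (n + 1 : ℝ≥0∞)⁻¹) atTop (𝓝 0) := by
      have := (tendsto_add_atTop_iff_nat 1).2 ENNReal.tendsto_inv_nat_nhds_zero
      exact_mod_cast this
    have hconv : Tendsto (fun n => eLpNorm (η n - v) (ENNReal.ofReal p) (volume.restrict Ω))
        atTop (𝓝 0) := by
      refine tendsto_of_tendsto_of_tendsto_of_le_of_le tendsto_const_nhds hlim
        (fun _ => zero_le) fun n => ?_
      rw [eLpNorm_sub_comm]
      exact le_self_add.trans (hlt n).le
    obtain ⟨ns, hns, hae⟩ := (tendstoInMeasure_of_tendsto_eLpNorm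
      (by simpa using hp1.trans' one_pos) (fun n => (hη n).continuous.aestronglyMeasurable)
      hv.1.2.1.1 hconv).exists_seq_tendsto_ae
    have hF := Lp.eLpNorm_lim_le_liminf_eLpNorm (p := ENNReal.ofReal 2)
      (fun n => (hη (ns n)).continuous.aestronglyMeasurable) v hae
    refine hF.trans ?_
    have hbound : ∀ n, eLpNorm (η (ns n)) (ENNReal.ofReal 2) (volume.restrict Ω) ≤
        C * (w1pNorm Ω p v + ((ns n : ℕ) + 1 : ℝ≥0∞)⁻¹) := by
      intro n
      refine (hC _ (hη _) (hs _)).trans ?_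
      gcongr
      have hm := memW1p_of_contDiff (p := p) hΩ (hη (ns n)) (hc (ns n))
      have e : η (ns n) = v + (-1 : ℝ) • (v - η (ns n)) := by
        rw [neg_one_smul]
        abel
      have hsub := hv.1.sub hΩ hm
      calc w1pNorm Ω p (η (ns n)) = w1pNorm Ω p (v + (-1 : ℝ) • (v - η (ns n))) := by rw [← e]
        _ ≤ _ := w1pNorm_add_le hΩ hp1.le hv.1 (hsub.const_smul hΩ _)
        _ ≤ _ := by
          rw [w1pNorm_const_smul hΩ _ hsub.1]
          gcongr
          simpa using (hlt (ns n)).le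
    have hlim2 : Tendsto (fun n => (C : ℝ≥0∞) * (w1pNorm Ω p v + ((ns n : ℕ) + 1 : ℝ≥0∞)⁻¹)) atTop
        (𝓝 (C * (w1pNorm Ω p v + 0))) :=
      ENNReal.Tendsto.const_mul (tendsto_const_nhds.add (hlim.comp hns.tendsto_atTop))
        (.inr ENNReal.coe_ne_top)
    rw [add_zero] at hlim2
    rw [← hlim2.liminf_eq]
    exact liminf_le_liminf (Eventually.of_forall hbound)
  -- For `p ≥ 2` boundedness of `Ω` suffices.
  · have hfin : volume.restrict Ω univ ≠ ⊤ := by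
      rw [Measure.restrict_apply_univ]
      exact hΩb.measure_lt_top.ne
    have hexp : 0 ≤ 1 / (ENNReal.ofReal 2).toReal - 1 / (ENNReal.ofReal p).toReal := by
      rw [ENNReal.toReal_ofReal (by norm_num), ENNReal.toReal_ofReal (by linarith), sub_nonneg]
      gcongr
    refine ⟨(volume.restrict Ω univ ^
      (1 / (ENNReal.ofReal 2).toReal - 1 / (ENNReal.ofReal p).toReal)).toNNReal, fun v hv => ?_⟩
    rw [ENNReal.coe_toNNReal (ENNReal.rpow_ne_top_of_nonneg hexp hfin), mul_comm]
    refine (eLpNorm_le_eLpNorm_mul_rpow_measure_univ (ENNReal.ofReal_le_ofReal hp2)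
      hv.1.2.1.1).trans ?_
    gcongr
    exact le_self_add

end Embedding

/-! ### The symmetric gradient and the stress form -/

section SymPart

variable {d : ℕ}

lemma symPart_add (P Q : Tensor d) : symPart (P + Q) = symPart P + symPart Q := by
  ext ij
  simp only [symPart, PiLp.add_apply]
  ring

lemma symPart_smul (c : ℝ) (P : Tensor d) : symPart (c • P) = c • symPart P := by
  ext ij
  simp only [symPart, PiLp.smul_apply, smul_eq_mul]
  ring

lemma symPart_symPart (P : Tensor d) : symPart (symPart P) = symPart P := by
  ext ij
  simp only [symPart]
  ring

lemma inner_symPart_symPart (P Q : Tensor d) :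
    inner ℝ (symPart P) (symPart Q) = inner ℝ (symPart P) Q := by
  have hswap : ∑ ij : Fin d × Fin d, symPart P ij * Q (ij.2, ij.1) =
      ∑ ij : Fin d × Fin d, symPart P ij * Q ij := by
    rw [← (Equiv.prodComm (Fin d) (Fin d)).sum_comp]
    refine Finset.sum_congr rfl fun ij _ => ?_
    simp only [symPart, Equiv.prodComm_apply, Prod.swap, Prod.mk.eta]
    ring
  have e : ∀ R : Tensor d, inner ℝ (symPart P) R = ∑ ij, symPart P ij * R ij := fun R => by
    rw [PiLp.inner_apply]
    exact Finset.sum_congr rfl fun ij _ => by simp [mul_comm]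
  rw [e, e]
  have e2 : ∀ ij : Fin d × Fin d, symPart P ij * symPart Q ij =
      symPart P ij * Q ij / 2 + symPart P ij * Q (ij.2, ij.1) / 2 := fun ij => by
    simp only [symPart]
    ring
  rw [Finset.sum_congr rfl fun ij _ => e2 ij, Finset.sum_add_distrib, ← Finset.sum_div,
    ← Finset.sum_div, hswap]
  ring

lemma norm_symPart_le (P : Tensor d) : ‖symPart P‖ ≤ ‖P‖ := by
  have h1 := inner_symPart_symPart P P
  have h2 := real_inner_le_norm (symPart P) P
  rw [real_inner_self_eq_norm_sq] at h1
  by_contra! h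
  nlinarith [norm_nonneg P]

lemma continuous_symPart : Continuous (symPart : Tensor d → Tensor d) :=
  LinearMap.continuous_of_finiteDimensional
    (⟨⟨symPart, symPart_add⟩, symPart_smul⟩ : Tensor d →ₗ[ℝ] Tensor d)

lemma stress_eq_powerField (p δ : ℝ) (P : Tensor d) :
    stress p δ P = powerField δ (p - 2) (symPart P) := by
  rcases eq_or_ne ‖symPart P‖ 0 with h | h
  · simp [stress, powerField, norm_eq_zero.1 h]
  · rw [stress, powerField, phiDeriv, mul_div_cancel_right₀ _ h]

lemma natF_symPart (p δ : ℝ) (P : Tensor d) :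
    natF p δ (symPart P) = powerField δ ((p - 2) / 2) (symPart P) := by
  rw [natF, symPart_symPart, powerField]

lemma symPart_powerField_symPart (q δ : ℝ) (P : Tensor d) :
    symPart (powerField δ q (symPart P)) = powerField δ q (symPart P) := by
  rw [powerField, symPart_smul, symPart_symPart]

end SymPart

section Hoelder

variable {α E : Type*} [MeasurableSpace α] {μ : Measure α} [NormedAddCommGroup E]
  [InnerProductSpace ℝ E]

lemma integrable_inner_and_enorm_integral_le {q r : ℝ≥0∞} [q.HolderConjugate r] {f g : α → E}
    (hf : MemLp f q μ) (hg : MemLp g r μ) :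
    Integrable (fun x => inner ℝ (f x) (g x)) μ ∧
      ‖∫ x, inner ℝ (f x) (g x) ∂μ‖ₑ ≤ eLpNorm f q μ * eLpNorm g r μ := by
  have h1 : eLpNorm (fun x => inner ℝ (f x) (g x)) 1 μ ≤ eLpNorm f q μ * eLpNorm g r μ := by
    simpa using eLpNorm_le_eLpNorm_mul_eLpNorm'_of_norm (r := 1) hf.1 hg.1
      (fun x y => inner ℝ x y) 1 (Eventually.of_forall fun x => by
        simpa using norm_inner_le_norm (𝕜 := ℝ) (f x) (g x))
  refine ⟨memLp_one_iff_integrable.1 ⟨hf.1.inner hg.1, h1.trans_lt (ENNReal.mul_lt_top hf.2 hg.2)⟩,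
    (enorm_integral_le_lintegral_enorm _).trans ?_⟩
  rwa [← eLpNorm_one_eq_lintegral_enorm]

/-- The growth `|powerField δ q A| ≤ (δ + |A|)^(q + 1)` maps `L^p` to `L^(p / (q + 1))`; this is
`L^(p')` for the stress and `L²` for `F`. -/
lemma memLp_powerField {p δ q : ℝ} [IsFiniteMeasure μ] (hδ : 0 ≤ δ) (hq : -1 < q)
    {A : α → E} (hA : MemLp A (ENNReal.ofReal p) μ) :
    MemLp (fun x => powerField δ q (A x)) (ENNReal.ofReal (p / (q + 1))) μ := by
  have hq1 : 0 < q + 1 := by linarith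
  have hw : MemLp (fun x => δ + ‖A x‖) (ENNReal.ofReal p) μ := (memLp_const δ).add hA.norm
  have h1 := hw.norm_rpow_div (ENNReal.ofReal (q + 1))
  rw [← ENNReal.ofReal_div_of_pos hq1, ENNReal.toReal_ofReal hq1.le] at h1
  refine h1.of_le (((hw.1.aemeasurable.pow_const q).aestronglyMeasurable).smul hA.1)
    (Eventually.of_forall fun x => ?_)
  have h0 : 0 ≤ δ + ‖A x‖ := by positivity
  rw [powerField, norm_smul, Real.norm_of_nonneg h0, Real.norm_of_nonneg (by positivity),
    Real.norm_of_nonneg (by positivity)]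
  rcases h0.eq_or_lt with h | h
  · have : ‖A x‖ = 0 := le_antisymm (by linarith) (norm_nonneg _)
    rw [this, mul_zero]
    positivity
  · rw [Real.rpow_add_one h.ne']
    gcongr
    linarith

end Hoelder

section StressForm

variable {d : ℕ} {Ω : Set (Vec d)} {p δ : ℝ}

lemma lqNorm_two {κ : Type*} [Fintype κ] (u : Vec d → EuclideanSpace ℝ κ) :
    lqNorm Ω 2 u = eLpNorm u 2 (volume.restrict Ω) := by
  simp [lqNorm]

lemma memLp_symGrad {u : Vec d → Vec d} (hu : MemW1p Ω p u) :
    MemLp (symGrad Ω u) (ENNReal.ofReal p) (volume.restrict Ω) :=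
  hu.2.2.of_le (continuous_symPart.comp_aestronglyMeasurable hu.2.2.1)
    (Eventually.of_forall fun _ => norm_symPart_le _)

lemma symGrad_add_ae (hΩ : IsOpen Ω) {u v : Vec d → Vec d} (hu : MemW1p Ω p u)
    (hv : MemW1p Ω p v) :
    symGrad Ω (u + v) =ᵐ[volume.restrict Ω] fun x => symGrad Ω u x + symGrad Ω v x := by
  filter_upwards [weakGrad_add_ae hΩ hu.1 hv.1] with x hx
  rw [symGrad, hx, Pi.add_apply, symPart_add]
  rfl

lemma symGrad_sub_ae (hΩ : IsOpen Ω) {u v : Vec d → Vec d} (hu : MemW1p Ω p u)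
    (hv : MemW1p Ω p v) :
    symGrad Ω (u - v) =ᵐ[volume.restrict Ω] fun x => symGrad Ω u x - symGrad Ω v x := by
  filter_upwards [symGrad_add_ae hΩ (hu.sub hΩ hv) hv] with x hx
  rw [sub_add_cancel] at hx
  rw [hx, add_sub_cancel_right]

lemma lqNorm_symGrad_le (u : Vec d → Vec d) : lqNorm Ω p (symGrad Ω u) ≤ w1pNorm Ω p u :=
  (eLpNorm_mono fun _ => norm_symPart_le _).trans le_add_self

variable [IsFiniteMeasure (volume.restrict Ω)]

lemma memLp_stress (hp : 1 < p) (hδ : 0 ≤ δ) {u : Vec d → Vec d} (hu : MemW1p Ω p u) :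
    MemLp (fun x => stress p δ (symGrad Ω u x)) (ENNReal.ofReal (p / (p - 1)))
      (volume.restrict Ω) := by
  have h := memLp_powerField hδ (q := p - 2) (by linarith) (memLp_symGrad hu)
  rw [show p - 2 + 1 = p - 1 by ring] at h
  refine h.ae_eq (Eventually.of_forall fun x => ?_)
  simp only [stress_eq_powerField, symGrad, symPart_symPart]

lemma memLp_natF (hp : 1 < p) (hδ : 0 ≤ δ) {u : Vec d → Vec d} (hu : MemW1p Ω p u) :
    MemLp (fun x => natF p δ (symGrad Ω u x)) 2 (volume.restrict Ω) := by
  have h := memLp_powerField hδ (q := (p - 2) / 2) (by linarith) (memLp_symGrad hu)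
  have e : p / ((p - 2) / 2 + 1) = 2 := by
    have : p ≠ 0 := by linarith
    rw [show (p - 2) / 2 + 1 = p / 2 by ring]
    field_simp
  rw [e, ENNReal.ofReal_ofNat] at h
  refine h.ae_eq (Eventually.of_forall fun x => ?_)
  simp only [natF_symPart, symGrad]

lemma holderConjugate_ofReal (hp : 1 < p) :
    (ENNReal.ofReal (p / (p - 1))).HolderConjugate (ENNReal.ofReal p) :=
  (Real.HolderConjugate.conjExponent hp).symm.ennrealOfReal

lemma integrable_inner_stress (hp : 1 < p) (hδ : 0 ≤ δ) {u ξ : Vec d → Vec d}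
    (hu : MemW1p Ω p u) (hξ : MemW1p Ω p ξ) :
    Integrable (fun x => inner ℝ (stress p δ (symGrad Ω u x)) (symGrad Ω ξ x))
      (volume.restrict Ω) :=
  have := holderConjugate_ofReal hp
  (integrable_inner_and_enorm_integral_le (memLp_stress hp hδ hu) (memLp_symGrad hξ)).1

lemma enorm_stressForm_le (hp : 1 < p) (hδ : 0 ≤ δ) {u ξ : Vec d → Vec d}
    (hu : MemW1p Ω p u) (hξ : MemW1p Ω p ξ) :
    ‖stressForm Ω p δ u ξ‖ₑ ≤
      lqNorm Ω (p / (p - 1)) (fun x => stress p δ (symGrad Ω u x)) * w1pNorm Ω p ξ := by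
  have := holderConjugate_ofReal hp
  refine (integrable_inner_and_enorm_integral_le (memLp_stress hp hδ hu)
    (memLp_symGrad hξ)).2.trans ?_
  exact mul_le_mul_right (lqNorm_symGrad_le ξ) _

lemma stressForm_sub_right (hΩ : IsOpen Ω) (hp : 1 < p) (hδ : 0 ≤ δ) {u ξ ζ : Vec d → Vec d}
    (hu : MemW1p Ω p u) (hξ : MemW1p Ω p ξ) (hζ : MemW1p Ω p ζ) :
    stressForm Ω p δ u (ξ - ζ) = stressForm Ω p δ u ξ - stressForm Ω p δ u ζ := by
  unfold stressForm pairing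
  rw [← integral_sub (integrable_inner_stress hp hδ hu hξ) (integrable_inner_stress hp hδ hu hζ)]
  refine integral_congr_ae ?_
  filter_upwards [symGrad_sub_ae hΩ hξ hζ] with x hx
  rw [hx, inner_sub_right]

lemma integral_inner_stress_sub (hΩ : IsOpen Ω) (hp : 1 < p) (hδ : 0 ≤ δ)
    {v w z : Vec d → Vec d} (hv : MemW1p Ω p v) (hw : MemW1p Ω p w) (hz : MemW1p Ω p z) :
    Integrable (fun x => inner ℝ (stress p δ (symGrad Ω v x) - stress p δ (symGrad Ω w x))
      (symGrad Ω v x - symGrad Ω z x)) (volume.restrict Ω) ∧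
    stressForm Ω p δ v (v - z) - stressForm Ω p δ w (v - z) =
      ∫ x in Ω, inner ℝ (stress p δ (symGrad Ω v x) - stress p δ (symGrad Ω w x))
        (symGrad Ω v x - symGrad Ω z x) := by
  have hvz := hv.sub hΩ hz
  have h1 := integrable_inner_stress hp hδ hv hvz
  have h2 := integrable_inner_stress hp hδ hw hvz
  have hae : (fun x => inner ℝ (stress p δ (symGrad Ω v x)) (symGrad Ω (v - z) x) -
      inner ℝ (stress p δ (symGrad Ω w x)) (symGrad Ω (v - z) x)) =ᵐ[volume.restrict Ω]
      fun x => inner ℝ (stress p δ (symGrad Ω v x) - stress p δ (symGrad Ω w x))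
        (symGrad Ω v x - symGrad Ω z x) := by
    filter_upwards [symGrad_sub_ae hΩ hv hz] with x hx
    rw [hx, inner_sub_left]
  refine ⟨(h1.sub h2).congr hae, ?_⟩
  unfold stressForm pairing
  rw [← integral_sub h1 h2]
  exact integral_congr_ae hae

lemma norm_toLp_sq {E : Type*} [NormedAddCommGroup E] [InnerProductSpace ℝ E] {α : Type*}
    [MeasurableSpace α] {μ : Measure α} {f : α → E} (hf : MemLp f 2 μ) :
    ‖hf.toLp f‖ ^ 2 = ∫ x, ‖f x‖ ^ 2 ∂μ := by
  rw [← real_inner_self_eq_norm_sq, L2.inner_def]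
  refine integral_congr_ae ?_
  filter_upwards [hf.coeFn_toLp] with x hx
  rw [hx, real_inner_self_eq_norm_sq]

/-- The field `F(Dv)` as an element of `L²(Ω)`. -/
def natFLp (hp : 1 < p) (hδ : 0 ≤ δ) {v : Vec d → Vec d} (hv : MemW1p Ω p v) :
    Lp (Tensor d) 2 (volume.restrict Ω) :=
  (memLp_natF hp hδ hv).toLp fun x => natF p δ (symGrad Ω v x)

lemma norm_natFLp_sub_sq (hp : 1 < p) (hδ : 0 ≤ δ) {v w : Vec d → Vec d} (hv : MemW1p Ω p v)
    (hw : MemW1p Ω p w) :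
    ‖natFLp hp hδ hv - natFLp hp hδ hw‖ ^ 2 =
      ∫ x in Ω, ‖natF p δ (symGrad Ω v x) - natF p δ (symGrad Ω w x)‖ ^ 2 := by
  rw [natFLp, natFLp, ← MemLp.toLp_sub, norm_toLp_sq]
  rfl

lemma integrable_norm_natF_sub_sq (hp : 1 < p) (hδ : 0 ≤ δ) {v w : Vec d → Vec d}
    (hv : MemW1p Ω p v) (hw : MemW1p Ω p w) :
    Integrable (fun x => ‖natF p δ (symGrad Ω v x) - natF p δ (symGrad Ω w x)‖ ^ 2)
      (volume.restrict Ω) :=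
  ((memLp_natF hp hδ hv).sub (memLp_natF hp hδ hw)).integrable_norm_pow (by norm_num)

/-- Monotonicity of the stress form. -/
lemma mul_norm_natFLp_sub_sq_le (hΩ : IsOpen Ω) (hp : 1 < p) (hδ : 0 ≤ δ) {c : ℝ}
    (hc : ∀ A B : Tensor d,
      c * ‖powerField δ ((p - 2) / 2) A - powerField δ ((p - 2) / 2) B‖ ^ 2 ≤
        inner ℝ (powerField δ (p - 2) A - powerField δ (p - 2) B) (A - B))
    {v w : Vec d → Vec d} (hv : MemW1p Ω p v) (hw : MemW1p Ω p w) :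
    c * ‖natFLp hp hδ hv - natFLp hp hδ hw‖ ^ 2 ≤
      stressForm Ω p δ v (v - w) - stressForm Ω p δ w (v - w) := by
  obtain ⟨h1, h2⟩ := integral_inner_stress_sub hΩ hp hδ hv hw hw
  rw [h2, norm_natFLp_sub_sq, ← integral_const_mul]
  refine integral_mono ((integrable_norm_natF_sub_sq hp hδ hv hw).const_mul c) h1 fun x => ?_
  have := hc (symGrad Ω v x) (symGrad Ω w x)
  simpa only [symGrad, stress_eq_powerField, natF_symPart, symPart_symPart] using this

/-- Young's inequality for the stress form. -/
lemma abs_stressForm_sub_le (hΩ : IsOpen Ω) (hp : 1 < p) (hδ : 0 ≤ δ) {ε C : ℝ}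
    (hC : ∀ A B Z : Tensor d,
      ‖powerField δ (p - 2) A - powerField δ (p - 2) B‖ * ‖A - Z‖ ≤
        ε * ‖powerField δ ((p - 2) / 2) A - powerField δ ((p - 2) / 2) Z‖ ^ 2 +
        C * ‖powerField δ ((p - 2) / 2) A - powerField δ ((p - 2) / 2) B‖ ^ 2)
    {v w z : Vec d → Vec d} (hv : MemW1p Ω p v) (hw : MemW1p Ω p w) (hz : MemW1p Ω p z) :
    |stressForm Ω p δ v (v - z) - stressForm Ω p δ w (v - z)| ≤
      ε * ‖natFLp hp hδ hv - natFLp hp hδ hz‖ ^ 2 +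
      C * ‖natFLp hp hδ hv - natFLp hp hδ hw‖ ^ 2 := by
  obtain ⟨h1, h2⟩ := integral_inner_stress_sub hΩ hp hδ hv hw hz
  have hiz := (integrable_norm_natF_sub_sq hp hδ hv hz).const_mul ε
  have hiw := (integrable_norm_natF_sub_sq hp hδ hv hw).const_mul C
  rw [h2, norm_natFLp_sub_sq, norm_natFLp_sub_sq, ← integral_const_mul, ← integral_const_mul,
    ← integral_add hiz hiw]
  refine abs_integral_le_integral_abs.trans (integral_mono h1.abs (hiz.add hiw) fun x => ?_)
  refine (abs_real_inner_le_norm _ _).trans ?_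
  have := hC (symGrad Ω v x) (symGrad Ω w x) (symGrad Ω z x)
  simpa only [symGrad, stress_eq_powerField, natF_symPart, symPart_symPart] using this

end StressForm

/-! ### Integration by parts for the initial stress -/

section InitialStress

variable {d : ℕ} {Ω : Set (Vec d)} {p δ : ℝ}

/-- The row-wise divergence of a tensor field, as a linear function of its gradient. -/
def rowTrace (d : ℕ) : EuclideanSpace ℝ ((Fin d × Fin d) × Fin d) →L[ℝ] Vec d :=
  LinearMap.toContinuousLinearMap
    { toFun := fun H => WithLp.toLp 2 fun i => ∑ j, H ((i, j), j)
      map_add' := fun H H' => by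
        ext i
        simp [Finset.sum_add_distrib]
      map_smul' := fun c H => by
        ext i
        simp [Finset.mul_sum] }

lemma rowTrace_apply (H : EuclideanSpace ℝ ((Fin d × Fin d) × Fin d)) (i : Fin d) :
    rowTrace d H i = ∑ j, H ((i, j), j) := rfl

lemma stressForm_eq_neg_integral (hΩ : IsOpen Ω) {u η : Vec d → Vec d}
    (hS : WeaklyDifferentiable Ω fun x => stress p δ (symGrad Ω u x))
    (hη : ContDiff ℝ ∞ η) (hc : HasCompactSupport η) (hs : tsupport η ⊆ Ω) :
    stressForm Ω p δ u η = -∫ x in Ω, inner ℝ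
      (rowTrace d (weakGrad Ω (fun x => stress p δ (symGrad Ω u x)) x)) (η x) := by
  set S := fun x => stress p δ (symGrad Ω u x) with hSd
  set G := weakGrad Ω S with hG
  have hw : HasWeakGrad Ω S G := hS.hasWeakGrad
  have hηi : ∀ i, ContDiff ℝ ∞ fun x => η x i := fun i =>
    (EuclideanSpace.proj (𝕜 := ℝ) i).contDiff.comp hη
  have hci : ∀ i, HasCompactSupport fun x => η x i := fun i =>
    hc.comp_left (g := fun y : Vec d => y i) rfl
  have hsi : ∀ i, tsupport (fun x => η x i) ⊆ Ω := fun i =>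
    (closure_mono (Function.support_comp_subset (g := fun y : Vec d => y i) rfl η)).trans hs
  have e1 : stressForm Ω p δ u η = ∫ x in Ω, ∑ i, ∑ j,
      S x (i, j) * fderiv ℝ (fun x => η x i) x (EuclideanSpace.single j 1) := by
    unfold stressForm pairing
    refine integral_congr_ae ?_
    filter_upwards [(hasWeakGrad_classicalGrad hη).weakGrad_ae_eq hΩ] with x hx
    have hsym : S x = symPart (S x) := by
      simp only [hSd, stress_eq_powerField, symPart_powerField_symPart]
    rw [show stress p δ (symGrad Ω u x) = S x from rfl, hsym, symGrad, inner_symPart_symPart, hx,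
      ← hsym, PiLp.inner_apply, Fintype.sum_prod_type]
    refine Finset.sum_congr rfl fun i _ => Finset.sum_congr rfl fun j _ => ?_
    rw [fderiv_coord_eq_classicalGrad hη]
    simp [mul_comm]
  have e2 : ∀ x, inner ℝ (rowTrace d (G x)) (η x) = ∑ i, ∑ j, G x ((i, j), j) * η x i := by
    intro x
    rw [PiLp.inner_apply]
    refine Finset.sum_congr rfl fun i _ => ?_
    rw [rowTrace_apply, ← Finset.sum_mul]
    simp [mul_comm]
  simp_rw [e1, e2]
  have hi1 : ∀ i j, Integrable (fun x => S x (i, j) *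
      fderiv ℝ (fun x => η x i) x (EuclideanSpace.single j 1)) (volume.restrict Ω) := fun i j =>
    integrable_mul_fderiv (locallyIntegrableOn_coord hw.1 (i, j)) (hηi i) (hci i) (hsi i) _
  have hi2 : ∀ i j, Integrable (fun x => G x ((i, j), j) * η x i) (volume.restrict Ω) :=
    fun i j => integrable_mul_of_tsupport_subset (locallyIntegrableOn_coord hw.2.1 ((i, j), j))
      (hηi i).continuous (hci i) (hsi i)
  rw [integral_finsetSum _ fun i _ => integrable_finsetSum _ fun j _ => hi1 i j,
    integral_finsetSum _ fun i _ => integrable_finsetSum _ fun j _ => hi2 i j,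
    ← Finset.sum_neg_distrib]
  refine Finset.sum_congr rfl fun i _ => ?_
  rw [integral_finsetSum _ fun j _ => hi1 i j, integral_finsetSum _ fun j _ => hi2 i j,
    ← Finset.sum_neg_distrib]
  exact Finset.sum_congr rfl fun j _ => hw.2.2 _ (hηi i) (hci i) (hsi i) (i, j) j

/-- If `∇S(Du) ∈ L²`, then the stress form of `u` is bounded with respect to the norm of `L²` on
`W_0^{1,p}`. Test fields are handled by integration by parts; their density suffices because
`W_0^{1,p}` embeds into `L²`. -/
lemma enorm_stressForm_le_lqNorm [IsFiniteMeasure (volume.restrict Ω)] (hd : 2 ≤ d)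
    (hΩ : IsOpen Ω) (hΩb : Bornology.IsBounded Ω) (hp1 : 1 < p)
    (hp : 2 * (d : ℝ) / (d + 2) ≤ p) (hδ : 0 ≤ δ) {u ξ : Vec d → Vec d}
    (hu : MemW1p Ω p u) (hS : WeaklyDifferentiable Ω fun x => stress p δ (symGrad Ω u x))
    (hS2 : lqNorm Ω 2 (weakGrad Ω fun x => stress p δ (symGrad Ω u x)) ≠ ⊤)
    (hξ : MemW1pZero Ω p ξ) :
    ‖stressForm Ω p δ u ξ‖ₑ ≤
      ‖rowTrace d‖₊ * lqNorm Ω 2 (weakGrad Ω fun x => stress p δ (symGrad Ω u x)) *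
        lqNorm Ω 2 ξ := by
  obtain ⟨C, hC⟩ := exists_lqNorm_le_w1pNorm hd hΩ hΩb hp1 hp
  set G := weakGrad Ω fun x => stress p δ (symGrad Ω u x) with hG
  set K := lqNorm Ω 2 G with hK
  set B := lqNorm Ω (p / (p - 1)) fun x => stress p δ (symGrad Ω u x) with hB
  have hBtop : B ≠ ⊤ := (memLp_stress hp1 hδ hu).2.ne
  have hG2 : MemLp G 2 (volume.restrict Ω) := by
    refine ⟨hS.hasWeakGrad.2.1.aestronglyMeasurable, ?_⟩
    rw [← lqNorm_two]
    exact hS2.lt_top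
  have hdiv : MemLp (fun x => rowTrace d (G x)) 2 (volume.restrict Ω) :=
    (rowTrace d).comp_memLp' hG2
  have hdivle : eLpNorm (fun x => rowTrace d (G x)) 2 (volume.restrict Ω) ≤
      ‖rowTrace d‖₊ * K := by
    have h := eLpNorm_le_nnreal_smul_eLpNorm_of_ae_le_mul (μ := volume.restrict Ω)
      (f := fun x => rowTrace d (G x)) (g := G) (c := ‖rowTrace d‖₊)
      (Eventually.of_forall fun x => (rowTrace d).le_opNNNorm (G x)) 2
    rw [ENNReal.smul_def, smul_eq_mul] at h
    rwa [hK, lqNorm_two]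
  have htest : ∀ η : Vec d → Vec d, ContDiff ℝ ∞ η → HasCompactSupport η → tsupport η ⊆ Ω →
      ‖stressForm Ω p δ u η‖ₑ ≤ ‖rowTrace d‖₊ * K * lqNorm Ω 2 η := by
    intro η hη hc hs
    rw [stressForm_eq_neg_integral hΩ hS hη hc hs, enorm_neg]
    have hη2 : MemLp η 2 (volume.restrict Ω) :=
      (hη.continuous.memLp_of_hasCompactSupport hc).restrict _
    refine (integrable_inner_and_enorm_integral_le hdiv hη2).2.trans ?_
    rw [lqNorm_two]
    gcongr
  have hKtop : (‖rowTrace d‖₊ : ℝ≥0∞) * K ≠ ⊤ := ENNReal.mul_ne_top ENNReal.coe_ne_top hS2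
  set κ := (‖rowTrace d‖₊ : ℝ≥0∞) * K with hκ
  have happrox : ∀ n : ℕ, ‖stressForm Ω p δ u ξ‖ₑ ≤
      κ * lqNorm Ω 2 ξ + (B + κ * C) * (n + 1 : ℝ≥0∞)⁻¹ := by
    intro n
    obtain ⟨η, hη, hc, hs, hlt⟩ := hξ.2 (n + 1 : ℝ≥0∞)⁻¹ (by simp)
    have hηm := memW1pZero_of_contDiff (p := p) hΩ hη hc hs
    have hdiff := hξ.sub hΩ hp1.le hηm
    have h1 : stressForm Ω p δ u ξ = stressForm Ω p δ u (ξ - η) + stressForm Ω p δ u η := by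
      rw [stressForm_sub_right hΩ hp1 hδ hu hξ.1 hηm.1]
      ring
    have h2 : lqNorm Ω 2 η ≤ lqNorm Ω 2 ξ + C * w1pNorm Ω p (ξ - η) := by
      have e : η = ξ - (ξ - η) := by abel
      calc lqNorm Ω 2 η = lqNorm Ω 2 (ξ - (ξ - η)) := by rw [← e]
        _ ≤ lqNorm Ω 2 ξ + lqNorm Ω 2 (ξ - η) :=
          eLpNorm_sub_le hξ.1.2.1.1 hdiff.1.2.1.1 (by simp)
        _ ≤ _ := by
          gcongr
          exact hC _ hdiff
    calc ‖stressForm Ω p δ u ξ‖ₑ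
        ≤ ‖stressForm Ω p δ u (ξ - η)‖ₑ + ‖stressForm Ω p δ u η‖ₑ := by
          rw [h1]
          exact enorm_add_le _ _
      _ ≤ B * w1pNorm Ω p (ξ - η) + κ * (lqNorm Ω 2 ξ + C * w1pNorm Ω p (ξ - η)) := by
          gcongr
          · exact enorm_stressForm_le hp1 hδ hu hdiff.1
          · exact (htest η hη hc hs).trans (by gcongr)
      _ = κ * lqNorm Ω 2 ξ + (B + κ * C) * w1pNorm Ω p (ξ - η) := by ring
      _ ≤ _ := by gcongr
  have hlim : Tendsto (fun n : ℕ => κ * lqNorm Ω 2 ξ + (B + κ * C) * (n + 1 : ℝ≥0∞)⁻¹) atTop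
      (𝓝 (κ * lqNorm Ω 2 ξ + (B + κ * C) * 0)) := by
    have h0 : Tendsto (fun n : ℕ => (n + 1 : ℝ≥0∞)⁻¹) atTop (𝓝 0) := by
      have := (tendsto_add_atTop_iff_nat 1).2 ENNReal.tendsto_inv_nat_nhds_zero
      exact_mod_cast this
    exact tendsto_const_nhds.add (ENNReal.Tendsto.const_mul h0
      (.inr (ENNReal.add_ne_top.2 ⟨hBtop, ENNReal.mul_ne_top hKtop ENNReal.coe_ne_top⟩)))
  rw [mul_zero, add_zero] at hlim
  exact ge_of_tendsto' hlim happrox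

end InitialStress

/-! ### The discrete velocity spaces -/

section VelocitySpace

variable {d : ℕ} {Ω : Set (Vec d)} {p : ℝ}

lemma IsPolyOn.add {l : ℕ} {A : Set (Vec d)} {g h : Vec d → ℝ} (hg : IsPolyOn l A g)
    (hh : IsPolyOn l A h) : IsPolyOn l A fun x => g x + h x := by
  obtain ⟨P, hP, hPg⟩ := hg
  obtain ⟨Q, hQ, hQh⟩ := hh
  refine ⟨P + Q, (MvPolynomial.totalDegree_add P Q).trans (max_le hP hQ), fun x hx => ?_⟩
  simp only [map_add, hPg x hx, hQh x hx]

lemma IsPolyOn.const_mul {l : ℕ} {A : Set (Vec d)} {g : Vec d → ℝ} (hg : IsPolyOn l A g)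
    (c : ℝ) : IsPolyOn l A fun x => c * g x := by
  obtain ⟨P, hP, hPg⟩ := hg
  refine ⟨c • P, (MvPolynomial.totalDegree_smul_le c P).trans hP, fun x hx => ?_⟩
  simp only [MvPolynomial.smul_eval, hPg x hx]

lemma integrable_mul_weakDiv (hp : 1 < p) {q : Vec d → ℝ}
    (hq : MemLp q (ENNReal.ofReal (p / (p - 1))) (volume.restrict Ω)) {v : Vec d → Vec d}
    (hv : MemW1p Ω p v) : Integrable (fun x => q x * weakDiv Ω v x) (volume.restrict Ω) := by
  have := holderConjugate_ofReal hp
  have hdiv : MemLp (weakDiv Ω v) (ENNReal.ofReal p) (volume.restrict Ω) :=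
    memLp_finsetSum _ fun i _ => (EuclideanSpace.proj (𝕜 := ℝ) (i, i)).comp_memLp' hv.2.2
  exact hq.integrable_mul hdiv

/-- The space `V_h` as a linear subspace. -/
def velocitySubmodule (hΩ : IsOpen Ω) (hp : 1 < p) (𝒯 : Triangulation Ω) (k r : ℕ) :
    Submodule ℝ (Vec d → Vec d) where
  carrier := spaceV 𝒯 p k r
  add_mem' := by
    rintro u v ⟨⟨hu, hup, hu0⟩, hud⟩ ⟨⟨hv, hvp, hv0⟩, hvd⟩
    refine ⟨⟨hu.add hΩ hp.le hv, fun A hA i => (hup A hA i).add (hvp A hA i), fun x hx => ?_⟩,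
      fun q hq => ?_⟩
    · rw [Pi.add_apply, hu0 x hx, hv0 x hx, add_zero]
    · have hae : (fun x => q x * weakDiv Ω (u + v) x) =ᵐ[volume.restrict Ω]
          fun x => q x * weakDiv Ω u x + q x * weakDiv Ω v x := by
        filter_upwards [weakGrad_add_ae hΩ hu.1.1 hv.1.1] with x hx
        simp only [weakDiv, hx, Pi.add_apply, PiLp.add_apply, Finset.sum_add_distrib]
        ring
      rw [integral_congr_ae hae, integral_add (integrable_mul_weakDiv hp hq.1 hu.1)
        (integrable_mul_weakDiv hp hq.1 hv.1), hud q hq, hvd q hq, add_zero]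
  zero_mem' := by
    refine ⟨⟨memW1pZero_of_contDiff hΩ contDiff_const HasCompactSupport.zero (by simp),
      fun A _ i => ⟨0, by simp, fun x _ => by simp⟩, fun x _ => rfl⟩, fun q _ => ?_⟩
    refine integral_eq_zero_of_ae ?_
    filter_upwards [(HasWeakGrad.zero (κ := Fin d)).weakGrad_ae_eq hΩ] with x hx
    simp [weakDiv, hx]
  smul_mem' := by
    rintro c u ⟨⟨hu, hup, hu0⟩, hud⟩
    refine ⟨⟨hu.const_smul hΩ c, fun A hA i => (hup A hA i).const_mul c, fun x hx => ?_⟩,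
      fun q hq => ?_⟩
    · rw [Pi.smul_apply, hu0 x hx, smul_zero]
    · have hae : (fun x => q x * weakDiv Ω (c • u) x) =ᵐ[volume.restrict Ω]
          fun x => c * (q x * weakDiv Ω u x) := by
        filter_upwards [weakGrad_smul_ae hΩ c hu.1.1] with x hx
        simp only [weakDiv, hx, Pi.smul_apply, PiLp.smul_apply, smul_eq_mul, ← Finset.mul_sum]
        ring
      rw [integral_congr_ae hae, integral_const_mul, hud q hq, mul_zero]

/-- The inclusion of a space of square integrable fields into `L²(Ω)`. -/
def toL2 (V : Submodule ℝ (Vec d → Vec d)) (hV : ∀ v ∈ V, MemLp v 2 (volume.restrict Ω)) :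
    V →ₗ[ℝ] L2Vec Ω where
  toFun v := (hV v v.2).toLp v
  map_add' _ _ := rfl
  map_smul' _ _ := rfl

variable {V : Submodule ℝ (Vec d → Vec d)} {hV : ∀ v ∈ V, MemLp v 2 (volume.restrict Ω)}

lemma enorm_toL2 (v : V) : ‖toL2 V hV v‖ₑ = lqNorm Ω 2 (v : Vec d → Vec d) := by
  rw [lqNorm_two]
  exact Lp.enorm_toLp (hV v v.2)

lemma pairing_eq_inner_toL2 (v w : V) :
    pairing Ω (v : Vec d → Vec d) w = inner ℝ (toL2 V hV v) (toL2 V hV w) := by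
  rw [L2.inner_def]
  refine integral_congr_ae ?_
  filter_upwards [(hV v v.2).coeFn_toLp, (hV w w.2).coeFn_toLp] with x hx hy
  rw [← hx, ← hy]
  rfl

lemma pairing_Lp_eq_inner_toL2 (f : L2Vec Ω) (w : V) :
    pairing Ω f w = inner ℝ f (toL2 V hV w) := by
  rw [L2.inner_def]
  refine integral_congr_ae ?_
  filter_upwards [(hV w w.2).coeFn_toLp] with x hx
  rw [← hx]
  rfl

/-- A family of fields whose members with index in `s` belong to `V` is given on `s` by a family
in `V`. -/
lemma exists_lift_of_forall_mem {α : Type*} (s : Set α) (u : α → Vec d → Vec d)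
    (hu : ∀ t ∈ s, u t ∈ V) : ∃ U : α → V, ∀ t ∈ s, (U t : Vec d → Vec d) = u t := by
  classical
  refine ⟨fun t => if h : u t ∈ V then ⟨u t, h⟩ else 0, fun t ht => ?_⟩
  simp only [dif_pos (hu t ht)]

end VelocitySpace

/-! ### Bounds for the force -/

section Force

variable {H : Type*} [NormedAddCommGroup H] {T : ℝ}

lemma intervalIntegrable_and_integral_norm_le (hT : 0 ≤ T) {g : ℝ → H} {K : ℝ≥0}
    (hg : MemLp g 2 (volume.restrict (Ioo 0 T)))
    (hK : eLpNorm g 2 (volume.restrict (Ioo 0 T)) ≤ K) :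
    IntervalIntegrable g volume 0 T ∧ ∫ t in (0 : ℝ)..T, ‖g t‖ ≤ √T * K := by
  have hint : Integrable g (volume.restrict (Ioo 0 T)) := hg.integrable (by norm_num)
  refine ⟨(intervalIntegrable_iff_integrableOn_Ioo_of_le hT).2 hint, ?_⟩
  rw [intervalIntegral.integral_of_le hT, integral_Ioc_eq_integral_Ioo,
    integral_norm_eq_lintegral_enorm hint.1, ← eLpNorm_one_eq_lintegral_enorm]
  have h1 := eLpNorm_le_eLpNorm_mul_rpow_measure_univ (p := 1) (q := 2) (by norm_num) hg.1
  have e : (1 / (1 : ℝ≥0∞).toReal - 1 / (2 : ℝ≥0∞).toReal) = 1 / 2 := by norm_num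
  rw [e, Measure.restrict_apply_univ, Real.volume_Ioo, sub_zero,
    ENNReal.ofReal_rpow_of_nonneg hT (by norm_num), ← Real.sqrt_eq_rpow] at h1
  have h2 : eLpNorm g 1 (volume.restrict (Ioo 0 T)) ≤ ENNReal.ofReal (√T * K) := by
    refine h1.trans ?_
    rw [mul_comm, ENNReal.ofReal_mul (Real.sqrt_nonneg T), ENNReal.ofReal_coe_nnreal]
    gcongr
  exact ENNReal.toReal_le_of_le_ofReal (by positivity) h2

variable [NormedSpace ℝ H]

/-- A force with derivative `f'` has total variation at most `∫ ‖f'‖`; here this is expressed with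
the primitive `Φ` of `‖f'‖`, and the initial value is bounded by means of the time average. -/
lemma force_bounds (hT : 0 < T) {f f' : ℝ → H} {K : ℝ≥0}
    (hf' : MemLp f' 2 (volume.restrict (Ioo 0 T)))
    (hf : ∀ t ∈ Icc 0 T, f t = f 0 + ∫ s in (0 : ℝ)..t, f' s)
    (hK : eLpNorm f 2 (volume.restrict (Ioo 0 T)) ≤ K)
    (hK' : eLpNorm f' 2 (volume.restrict (Ioo 0 T)) ≤ K) :
    ContinuousOn f (Icc 0 T) ∧ ∃ Φ : ℝ → ℝ, ContinuousOn Φ (Icc 0 T) ∧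
      (∀ s ∈ Icc 0 T, ∀ t ∈ Icc 0 T, s ≤ t → ‖f t - f s‖ ≤ Φ t - Φ s) ∧
      Φ T - Φ 0 ≤ √T * K ∧ ‖f 0‖ ≤ √T * K / T + √T * K := by
  obtain ⟨hint, hle⟩ := intervalIntegrable_and_integral_norm_le hT.le hf' hK'
  have hu : uIcc 0 T = Icc 0 T := uIcc_of_le hT.le
  have hc : ContinuousOn f (Icc 0 T) := by
    have h1 := intervalIntegral.continuousOn_primitive_interval' hint left_mem_uIcc
    rw [hu] at h1
    exact (continuousOn_const.add h1).congr hf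
  have hsub : ∀ s ∈ Icc 0 T, ∀ t ∈ Icc 0 T, IntervalIntegrable f' volume s t := by
    intro s hs t ht
    refine hint.mono_set (uIcc_subset_uIcc ?_ ?_) <;> rwa [hu]
  have h0 : (0 : ℝ) ∈ Icc 0 T := ⟨le_rfl, hT.le⟩
  have hTT : T ∈ Icc 0 T := ⟨hT.le, le_rfl⟩
  have hmono : ∀ s ∈ Icc 0 T, ∀ t ∈ Icc 0 T, s ≤ t → ‖f t - f s‖ ≤
      (∫ r in (0 : ℝ)..t, ‖f' r‖) - ∫ r in (0 : ℝ)..s, ‖f' r‖ := by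
    intro s hs t ht hst
    rw [hf t ht, hf s hs, add_sub_add_left_eq_sub,
      intervalIntegral.integral_interval_sub_left (hsub 0 h0 t ht) (hsub 0 h0 s hs),
      intervalIntegral.integral_interval_sub_left (hsub 0 h0 t ht).norm (hsub 0 h0 s hs).norm]
    exact intervalIntegral.norm_integral_le_integral_norm hst
  refine ⟨hc, fun t => ∫ r in (0 : ℝ)..t, ‖f' r‖, ?_, hmono, ?_, ?_⟩
  · have h1 := intervalIntegral.continuousOn_primitive_interval' hint.norm left_mem_uIcc
    rwa [hu] at h1
  · simpa using hle
  · have hfm : MemLp f 2 (volume.restrict (Ioo 0 T)) :=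
      ⟨(hc.mono Ioo_subset_Icc_self).aestronglyMeasurable measurableSet_Ioo,
        hK.trans_lt ENNReal.coe_lt_top⟩
    obtain ⟨hfi, hfle⟩ := intervalIntegrable_and_integral_norm_le hT.le hfm hK
    have hpt : ∀ t ∈ Icc 0 T, ‖f 0‖ - √T * K ≤ ‖f t‖ := by
      intro t ht
      have h1 := hmono 0 h0 t ht ht.1
      have h2 := hmono t ht T hTT ht.2
      have h3 := norm_sub_norm_le (f 0) (f t)
      rw [norm_sub_rev] at h3
      rw [intervalIntegral.integral_same] at h1
      have h4 := (norm_nonneg _).trans h2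
      linarith
    have h1 := intervalIntegral.integral_mono_on (μ := volume) hT.le
      intervalIntegrable_const hfi.norm hpt
    rw [intervalIntegral.integral_const, smul_eq_mul, sub_zero] at h1
    have h2 : ‖f 0‖ - √T * K ≤ √T * K / T := by
      rw [le_div_iff₀ hT]
      linarith
    linarith

end Force

/-! ### The error estimate -/

section ErrorEstimate

variable {d : ℕ} {Ω : Set (Vec d)} {p δ : ℝ}

/-- Curves that are `C¹` with respect to `W^{1,p}` are `C¹` in `L²`. -/
lemma IsC1Curve.toL2 {T : ℝ} {V : Submodule ℝ (Vec d → Vec d)}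
    {hV : ∀ v ∈ V, MemLp v 2 (volume.restrict Ω)} {C : ℝ≥0}
    (hC : ∀ v ∈ V, lqNorm Ω 2 v ≤ C * w1pNorm Ω p v) {u u' : ℝ → Vec d → Vec d}
    (hu : IsC1Curve Ω p T V u u') {U U' : ℝ → V}
    (hU : ∀ t ∈ Icc 0 T, (U t : Vec d → Vec d) = u t)
    (hU' : ∀ t ∈ Icc 0 T, (U' t : Vec d → Vec d) = u' t) :
    (∀ t ∈ Icc 0 T, HasDerivWithinAt (fun s => toL2 V hV (U s)) (toL2 V hV (U' t)) (Icc 0 T) t) ∧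
      ContinuousOn (fun t => toL2 V hV (U' t)) (Icc 0 T) := by
  have hle : ∀ v : V, ‖GenStokes.toL2 V hV v‖ₑ ≤ C * w1pNorm Ω p (v : Vec d → Vec d) :=
    fun v => (enorm_toL2 v).trans_le (hC v v.2)
  have hlim : ∀ {l : Filter ℝ} {φ : ℝ → ℝ≥0∞}, Tendsto φ l (𝓝 0) →
      Tendsto (fun s => (C : ℝ≥0∞) * φ s) l (𝓝 0) := fun h => by
    simpa using ENNReal.Tendsto.const_mul h (.inr ENNReal.coe_ne_top)
  refine ⟨fun t ht => ?_, fun t ht => ?_⟩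
  · rw [hasDerivWithinAt_iff_tendsto_slope, tendsto_iff_edist_tendsto_0]
    refine tendsto_of_tendsto_of_tendsto_of_le_of_le' tendsto_const_nhds
      (hlim (hu t ht).2.2.1) (Eventually.of_forall fun _ => zero_le) ?_
    filter_upwards [self_mem_nhdsWithin] with s hs
    rw [edist_eq_enorm_sub, slope_def_module, ← map_sub, ← map_smul, ← map_sub]
    refine (hle _).trans (le_of_eq ?_)
    simp only [Submodule.coe_sub, Submodule.coe_smul, hU s hs.1, hU t ht, hU' t ht]
  · rw [ContinuousWithinAt, tendsto_iff_edist_tendsto_0]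
    refine tendsto_of_tendsto_of_tendsto_of_le_of_le' tendsto_const_nhds
      (hlim (hu t ht).2.2.2) (Eventually.of_forall fun _ => zero_le) ?_
    filter_upwards [self_mem_nhdsWithin] with s hs
    rw [edist_eq_enorm_sub, ← map_sub]
    refine (hle _).trans (le_of_eq ?_)
    simp only [Submodule.coe_sub, hU' s hs, hU' t ht]

/-- The error estimate for Galerkin approximations in an arbitrary linear subspace of
`W_0^{1,p}(Ω)`. -/
theorem galerkin_euler_error (hd : 2 ≤ d) (hΩ : IsOpen Ω) (hΩb : Bornology.IsBounded Ω)
    (hp1 : 1 < p) (hp : 2 * (d : ℝ) / (d + 2) ≤ p) (hδ : 0 ≤ δ) {T : ℝ} (hT : 0 < T) {K₁ : ℝ≥0}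
    {c C : ℝ} (hc : 0 < c) (hC : 0 ≤ C)
    (hmono : ∀ A B : Tensor d,
      c * ‖powerField δ ((p - 2) / 2) A - powerField δ ((p - 2) / 2) B‖ ^ 2 ≤
        inner ℝ (powerField δ (p - 2) A - powerField δ (p - 2) B) (A - B))
    (hyoung : ∀ A B Z : Tensor d,
      ‖powerField δ (p - 2) A - powerField δ (p - 2) B‖ * ‖A - Z‖ ≤
        c / 2 * ‖powerField δ ((p - 2) / 2) A - powerField δ ((p - 2) / 2) Z‖ ^ 2 +
        C * ‖powerField δ ((p - 2) / 2) A - powerField δ ((p - 2) / 2) B‖ ^ 2)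
    {f f' : ℝ → L2Vec Ω} {u₀ : Vec d → Vec d} (hdata : AdmissibleData Ω p δ T K₁ f f' u₀)
    (V : Submodule ℝ (Vec d → Vec d)) (hV : ∀ v ∈ V, MemW1pZero Ω p v) {u₀h : Vec d → Vec d}
    (hinit : IsDiscreteInitialValue Ω p δ V u₀ u₀h) {u : ℝ → Vec d → Vec d}
    (hu : IsSemidiscreteSolution p δ T V f u₀h u) {M : ℕ} {τ : ℝ} (hτ : 0 < τ) (hMτ : M * τ = T)
    {U : ℕ → Vec d → Vec d} (hU : IsEulerSolution p δ τ M V f u₀h U) :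
    ∀ n ≤ M, lqNorm Ω 2 (u (n * τ) - U n) ^ 2 + ENNReal.ofReal c * (ENNReal.ofReal τ *
      ∑ j ∈ Finset.Icc 1 n, lqNorm Ω 2 (fun x => natF p δ (symGrad Ω (u (j * τ)) x) -
        natF p δ (symGrad Ω (U j) x)) ^ 2) ≤
      ENNReal.ofReal (2 * C / c * (√T * K₁ / T + 3 * (√T * K₁) + ‖rowTrace d‖ * K₁) ^ 2) *
        ENNReal.ofReal τ ^ 2 := by
  have hfin : IsFiniteMeasure (volume.restrict Ω) :=
    ⟨by rw [Measure.restrict_apply_univ]; exact hΩb.measure_lt_top⟩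
  obtain ⟨Ce, hCe⟩ := exists_lqNorm_le_w1pNorm hd hΩ hΩb hp1 hp
  have hV2 : ∀ v ∈ V, MemLp v 2 (volume.restrict Ω) := fun v hv => by
    refine ⟨(hV v hv).1.2.1.1, ?_⟩
    rw [← lqNorm_two]
    exact (hCe v (hV v hv)).trans_lt
      (ENNReal.mul_lt_top ENNReal.coe_lt_top (w1pNorm_lt_top (hV v hv).1))
  have hVm : ∀ v : V, MemW1p Ω p (v : Vec d → Vec d) := fun v => (hV v v.2).1
  -- Bounds for the data.
  have hb1 : l2TimeNorm T f ≤ K₁ :=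
    ((le_self_add.trans le_self_add).trans (le_self_add.trans le_self_add)).trans hdata.bound
  have hb2 : l2TimeNorm T f' ≤ K₁ :=
    ((le_add_self.trans le_self_add).trans (le_self_add.trans le_self_add)).trans hdata.bound
  have hb3 : lqNorm Ω 2 (weakGrad Ω fun x => stress p δ (symGrad Ω u₀ x)) ≤ K₁ :=
    le_add_self.trans hdata.bound
  obtain ⟨hfc, Φ, hΦ, hfΦ, hΦT, hf0⟩ := force_bounds hT hdata.force.1 hdata.force.2 hb1 hb2
  -- Lift the curves to the subspace.
  obtain ⟨hu0, u', hcurve, hsol⟩ := hu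
  obtain ⟨Us, hUs⟩ := exists_lift_of_forall_mem (V := V) (Icc 0 T) u fun t ht => (hcurve t ht).1
  obtain ⟨Us', hUs'⟩ := exists_lift_of_forall_mem (V := V) (Icc 0 T) u'
    fun t ht => (hcurve t ht).2.1
  have hUmem : ∀ n ≤ M, U n ∈ V := by
    intro n hn
    rcases Nat.eq_zero_or_pos n with rfl | hpos
    · rw [hU.1]
      exact hinit.1
    · exact (hU.2 n (Finset.mem_Icc.2 ⟨hpos, hn⟩)).1
  obtain ⟨W, hW⟩ := exists_lift_of_forall_mem (V := V) {n | n ≤ M} U hUmem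
  obtain ⟨hderiv, hcont⟩ := hcurve.toL2 (hV := hV2) (fun v hv => hCe v (hV v hv)) hUs hUs'
  have h0T : (0 : ℝ) ∈ Icc 0 T := ⟨le_rfl, hT.le⟩
  have htn : ∀ n : ℕ, n ≤ M → (n : ℝ) * τ ∈ Icc 0 T := by
    intro n hn
    refine ⟨by positivity, ?_⟩
    rw [← hMτ]
    gcongr
  have hW0 : W 0 = Us 0 := by
    refine Subtype.ext ?_
    rw [hW 0 (Nat.zero_le M), hUs 0 h0T, hU.1, hu0]
  have key := euler_error (Λ := ‖rowTrace d‖ * K₁) hT hc hC (by positivity) (toL2 V hV2)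
    (fun v => natFLp hp1 hδ (hVm v)) (fun v w => stressForm Ω p δ v w)
    (fun v w => mul_norm_natFLp_sub_sq_le hΩ hp1 hδ hmono (hVm v) (hVm w))
    (fun v w z => abs_stressForm_sub_le hΩ hp1 hδ hyoung (hVm v) (hVm w) (hVm z))
    hfc hΦ hfΦ hderiv hcont
    (fun t ht ξ => by
      rw [← pairing_eq_inner_toL2, ← pairing_Lp_eq_inner_toL2, hUs t ht, hUs' t ht]
      exact hsol t ht ξ ξ.2)
    (fun ξ => by
      rw [hUs 0 h0T, hu0, hinit.2 ξ ξ.2]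
      have h1 := enorm_stressForm_le_lqNorm hd hΩ hΩb hp1 hp hδ hdata.initial.1.1
        hdata.weaklyDiff_stress (ne_top_of_le_ne_top ENNReal.coe_ne_top hb3) (hV ξ ξ.2)
      rw [← enorm_toL2 (hV := hV2)] at h1
      have h2 : ‖stressForm Ω p δ u₀ ξ‖ₑ ≤ ‖rowTrace d‖₊ * K₁ * ‖toL2 V hV2 ξ‖ₑ :=
        h1.trans (by gcongr)
      rw [enorm_eq_nnnorm, enorm_eq_nnnorm] at h2
      exact_mod_cast h2)
    hτ hMτ hW0
    (fun n hn ξ => by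
      have hnM := (Finset.mem_Icc.1 hn).2
      have h1 := (hU.2 n hn).2 ξ ξ.2
      rw [← pairing_eq_inner_toL2, ← pairing_Lp_eq_inner_toL2, Submodule.coe_smul,
        Submodule.coe_sub, hW n hnM, hW (n - 1) ((Nat.sub_le n 1).trans hnM)]
      exact h1)
  intro n hn
  have hn' := key n hn
  have hL : lqNorm Ω 2 (u (n * τ) - U n) ^ 2 =
      ENNReal.ofReal (‖toL2 V hV2 (Us (n * τ) - W n)‖ ^ 2) := by
    rw [ENNReal.ofReal_pow (norm_nonneg _), ofReal_norm, enorm_toL2, Submodule.coe_sub,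
      hUs _ (htn n hn), hW n hn]
  have hF : ∀ j ∈ Finset.Icc 1 n, lqNorm Ω 2 (fun x => natF p δ (symGrad Ω (u (j * τ)) x) -
      natF p δ (symGrad Ω (U j) x)) ^ 2 = ENNReal.ofReal
        (‖natFLp hp1 hδ (hVm (Us (j * τ))) - natFLp hp1 hδ (hVm (W j))‖ ^ 2) := by
    intro j hj
    have hjM := (Finset.mem_Icc.1 hj).2.trans hn
    rw [ENNReal.ofReal_pow (norm_nonneg _), ofReal_norm, natFLp, natFLp, ← MemLp.toLp_sub,
      Lp.enorm_toLp, lqNorm_two, hUs _ (htn j hjM), hW j hjM]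
    rfl
  rw [hL, Finset.sum_congr rfl hF, ← ENNReal.ofReal_sum_of_nonneg fun _ _ => by positivity,
    ← ENNReal.ofReal_mul hτ.le, ← ENNReal.ofReal_mul hc.le,
    ← ENNReal.ofReal_add (by positivity) (by positivity), ← ENNReal.ofReal_pow hτ.le,
    ← ENNReal.ofReal_mul (by positivity)]
  refine ENNReal.ofReal_le_ofReal (hn'.trans ?_)
  have hΦ0 : 0 ≤ Φ T - Φ 0 :=
    (norm_nonneg _).trans (hfΦ 0 h0T T ⟨hT.le, le_rfl⟩ hT.le)
  have hB : ‖f 0‖ + ‖rowTrace d‖ * K₁ + 2 * (Φ T - Φ 0) ≤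
      √T * K₁ / T + 3 * (√T * K₁) + ‖rowTrace d‖ * K₁ := by linarith
  gcongr

end ErrorEstimate

end

end GenStokes

open GenStokes
theorem mainTheorem3 (d : ℕ) (hd : 2 ≤ d) (Ω : Set (Vec d)) (hΩ_open : IsOpen Ω)
    (hΩ_conn : IsConnected Ω) (hΩ_bdd : Bornology.IsBounded Ω)
    (p : ℝ) (hp_one : 1 < p) (hp : 2 * (d : ℝ) / (d + 2) ≤ p)
    (T : ℝ) (hT : 0 < T) (K₁ : ℝ≥0) :
    ∃ c : ℝ≥0,
      ∀ (δ : ℝ), δ ∈ Icc (0 : ℝ) 1 →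
      ∀ (f f' : ℝ → L2Vec Ω) (u₀ : Vec d → Vec d), AdmissibleData Ω p δ T K₁ f f' u₀ →
      ∀ (𝒯 : Triangulation Ω) (k r : ℕ) (u₀h : Vec d → Vec d),
        IsDiscreteInitialValue Ω p δ (spaceV 𝒯 p k r) u₀ u₀h →
      ∀ (u : ℝ → Vec d → Vec d),
        IsSemidiscreteSolution p δ T (spaceV 𝒯 p k r) f u₀h u →
      ∀ (M : ℕ) (α Δt : ℝ), 1 ≤ M → Δt = T / M → Δt ≤ α → α < 1 →
      ∀ (U : ℕ → Vec d → Vec d),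
        IsEulerSolution p δ Δt M (spaceV 𝒯 p k r) f u₀h U →
        (⨆ n ∈ Finset.Icc 1 M, lqNorm Ω 2 (u (n * Δt) - U n) ^ 2) +
            ENNReal.ofReal Δt * ∑ n ∈ Finset.Icc 1 M,
              lqNorm Ω 2 (fun x => natF p δ (symGrad Ω (u (n * Δt)) x) -
                natF p δ (symGrad Ω (U n) x)) ^ 2
          ≤ c * ENNReal.ofReal Δt ^ 2 := by
  obtain ⟨c, hc, hmono⟩ := exists_monotone_powerField (E := Tensor d) hp_one
  obtain ⟨C, hC, hyoung⟩ := exists_young_powerField (E := Tensor d) hp_one (half_pos hc)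
  set B := 2 * C / c * (√T * K₁ / T + 3 * (√T * K₁) + ‖rowTrace d‖ * K₁) ^ 2 with hB
  refine ⟨B.toNNReal + (B / c).toNNReal, ?_⟩
  intro δ hδ f f' u₀ hdata 𝒯 k r u₀h hinit u hu M α Δt hM hΔt _ _ U hU
  have hM0 : (0 : ℝ) < M := by exact_mod_cast hM
  have hτ : 0 < Δt := hΔt ▸ div_pos hT hM0
  have hMτ : M * Δt = T := by
    rw [hΔt]
    field_simp
  have key := galerkin_euler_error hd hΩ_open hΩ_bdd hp_one hp hδ.1 hT hc hC
    (hmono δ hδ.1) (hyoung δ hδ.1) hdata (velocitySubmodule hΩ_open hp_one 𝒯 k r)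
    (fun v hv => hv.1.1) hinit hu hτ hMτ hU
  rw [← hB] at key
  have hsum := le_add_self.trans (key M le_rfl)
  have hc0 : ENNReal.ofReal c ≠ 0 := by simpa using hc
  rw [ENNReal.coe_add, add_mul]
  refine add_le_add (iSup₂_le fun n hn => ?_) ?_
  · exact le_self_add.trans (key n (Finset.mem_Icc.1 hn).2)
  · change _ ≤ ENNReal.ofReal (B / c) * _
    rw [ENNReal.ofReal_div_of_pos hc, div_eq_mul_inv, mul_right_comm, ← div_eq_mul_inv,
      ENNReal.le_div_iff_mul_le (.inl hc0) (.inl ENNReal.ofReal_ne_top), mul_comm]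
    exact hsum
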